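/- Let $\mathcal H$ be the Hilbert space of one bosonic mode, with Fock basis $\{|n\rangle\}_{n\in\mathbb N}$ and annihilation operator $a$, $a|n\rangle=\sqrt n\,|n-1\rangle$. For $\lambda\in[0,1]$ and a density operator $\sigma$ on an environment mode $E$ (a copy of $\mathcal H$), the general attenuator is the quantum channel $$\Phi_{\lambda,\sigma}(\rho)=\operatorname{Tr}_E\big[U_\lambda(\rho\otimes\sigma)U_\lambda^\dagger\big],\qquad U_\lambda=\exp\big[\arccos\sqrt\lambda\,(a_1^\dagger a_2-a_1a_2^\dagger)\big],$$ where $a_1,a_2$ are the annihilation operators of the input mode and of the environment mode. For $N>0$ let $\tau_N=\frac1{N+1}\sum_{n\ge0}\big(\frac N{N+1}\big)^n|n\rangle\langle n|$ be the thermal state with mean photon number $N$. For a quantum channel $\Phi$ and a state $\rho$, the coherent information is $$I_{\mathrm{coh}}(\Phi,\rho)=S(\Phi(\rho))-S\big((\Phi\otimes\mathrm{Id})(|\psi\rangle\langle\psi|)\big),$$ where $|\psi\rangle$ is any purification of $\rho$ and $S(\rho)=-\operatorname{Tr}[\rho\log_2\rho]$. Let $H(p)=-\sum_k p_k\log_2p_k$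 denote the Shannon entropy. **Theorem.** Let $N>0$ and $c>0$, and for $k\in\mathbb Z$ put $$q_k(N,c)=e^{-c(2N+1)}\Big(\frac N{N+1}\Big)^{k/2}I_{|k|}\big(2c\sqrt{N(N+1)}\big),$$ $$p_k(N,c)=\begin{cases}\dfrac{N^k}{(N+1)^{k+1}}\,e^{-c/(N+1)}\,L_k\Big(-\dfrac c{N(N+1)}\Big),&k\ge0,\\[1ex]0,&k<0,\end{cases}$$ where, for $k\in\mathbb N$, $I_k(z)=\big(\frac z2\big)^k\sum_{m=0}^\infty\frac{(z/2)^{2m}}{m!\,(k+m)!}$ is the modified Bessel function of the first kind and $L_k(x)=\sum_{m=0}^k\frac{(-1)^m}{m!}\binom kmx^m$ is the Laguerre polynomial. Then $q(N,c)=\{q_k(N,c)\}_{k\in\mathbb Z}$ and $p(N,c)=\{p_k(N,c)\}_{k\in\mathbb Z}$ are probability distributions with finite Shannon entropy, and $$\liminf_{n\to\infty}I_{\mathrm{coh}}\big(\Phi_{c/n,\,|n\rangle\langle n|},\tau_N\big)\ \ge\ H(q(N,c))-H(p(N,c)).$$ -/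

import Mathlib

open scoped ENNReal lp

noncomputable section

namespace Bosonic

/-! ### Operators on `ℓ²` spaces

`ℓ²(ℕ, ℂ)` is the Hilbert space of one bosonic mode, the vector `ket n` being the `n`-th Fock state;
`ℓ²(ι × κ, ℂ)` is the Hilbert tensor product of `ℓ²(ι, ℂ)` and `ℓ²(κ, ℂ)`. -/

/-- Bounded operators on `ℓ²(ι, ℂ)`. -/
abbrev Op (ι : Type*) := ℓ²(ι, ℂ) →L[ℂ] ℓ²(ι, ℂ)

/-- A linear map into functions whose values have uniformly bounded square sums is a bounded
operator between `ℓ²` spaces. -/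
def mkOp {ι κ : Type*} (f : ℓ²(ι, ℂ) →ₗ[ℂ] (κ → ℂ)) (C : ℝ) (hC : 0 ≤ C)
    (h : ∀ x, ∀ s : Finset κ, ∑ k ∈ s, ‖f x k‖ ^ 2 ≤ (C * ‖x‖) ^ 2) :
    ℓ²(ι, ℂ) →L[ℂ] ℓ²(κ, ℂ) :=
  LinearMap.mkContinuous
    { toFun := fun x => ⟨f x, memℓp_gen' (C := (C * ‖x‖) ^ 2) (by simpa using h x)⟩
      map_add' := fun x y => by ext k; exact congrFun (map_add f x y) k
      map_smul' := fun c x => by ext k; exact congrFun (map_smul f c x) k }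
    C
    (fun x => lp.norm_le_of_forall_sum_le (by simp) (by positivity) (by simpa using h x))

@[simp] theorem mkOp_apply {ι κ : Type*} (f : ℓ²(ι, ℂ) →ₗ[ℂ] (κ → ℂ)) (C : ℝ) (hC : 0 ≤ C)
    (h : ∀ x, ∀ s : Finset κ, ∑ k ∈ s, ‖f x k‖ ^ 2 ≤ (C * ‖x‖) ^ 2) (x : ℓ²(ι, ℂ)) (k : κ) :
    mkOp f C hC h x k = f x k := rfl

theorem sum_sq_le {ι : Type*} (x : ℓ²(ι, ℂ)) (s : Finset ι) : ∑ i ∈ s, ‖x i‖ ^ 2 ≤ ‖x‖ ^ 2 := by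
  simpa using lp.sum_rpow_le_norm_rpow (p := 2) (by simp) x s

theorem hasSum_sq {ι : Type*} (x : ℓ²(ι, ℂ)) : HasSum (fun i => ‖x i‖ ^ 2) (‖x‖ ^ 2) := by
  simpa using lp.hasSum_norm (p := 2) (by simp) x

open Classical in
/-- The basis vector `|i⟩`. -/
def ket {ι : Type*} (i : ι) : ℓ²(ι, ℂ) := lp.single 2 i (1 : ℂ)

/-- The rank-one operator `|ψ⟩⟨ψ|`. -/
def proj {ι : Type*} (ψ : ℓ²(ι, ℂ)) : Op ι := InnerProductSpace.rankOne ℂ ψ ψ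

/-- The operator `1 ⊗ ⟨k|`, which maps `x` to its `k`-th slice. Its adjoint is `1 ⊗ |k⟩`. -/
def sliceR {ι κ : Type*} (k : κ) : ℓ²(ι × κ, ℂ) →L[ℂ] ℓ²(ι, ℂ) :=
  mkOp
    { toFun := fun x i => x (i, k)
      map_add' := fun x y => by ext i; simp
      map_smul' := fun c x => by ext i; simp }
    1 zero_le_one
    (fun x s => by
      have h := sum_sq_le x (s.map ⟨fun i => (i, k), fun a b hab => by simpa using hab⟩)
      rw [Finset.sum_map] at h
      rw [one_mul]
      exact h)

/-- The operator `⟨i| ⊗ 1`. -/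
def sliceL {ι κ : Type*} (i : ι) : ℓ²(ι × κ, ℂ) →L[ℂ] ℓ²(κ, ℂ) :=
  mkOp
    { toFun := fun x k => x (i, k)
      map_add' := fun x y => by ext k; simp
      map_smul' := fun c x => by ext k; simp }
    1 zero_le_one
    (fun x s => by
      have h := sum_sq_le x (s.map ⟨fun k => (i, k), fun a b hab => by simpa using hab⟩)
      rw [Finset.sum_map] at h
      rw [one_mul]
      exact h)

theorem sum_slice_sq_le {ι κ γ : Type*} (e : γ × κ ≃ ι) (x : ℓ²(ι, ℂ)) (y : κ → ℓ²(γ, ℂ))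
    (hy : ∀ k g, y k g = x (e (g, k))) (s : Finset κ) : ∑ k ∈ s, ‖y k‖ ^ 2 ≤ ‖x‖ ^ 2 := by
  have h1 : HasSum (fun p : κ × γ => ‖x (e (p.2, p.1))‖ ^ 2) (‖x‖ ^ 2) :=
    (((Equiv.prodComm κ γ).trans e).hasSum_iff (f := fun i => ‖x i‖ ^ 2)).2 (hasSum_sq x)
  have h2 : HasSum (fun k => ‖y k‖ ^ 2) (‖x‖ ^ 2) :=
    h1.prod_fiberwise (fun k => by simpa [hy] using hasSum_sq (y k))
  exact sum_le_hasSum s (fun _ _ => by positivity) h2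

theorem sum_op_slice_sq_le {ι κ γ : Type*} (e : γ × κ ≃ ι) (A : Op γ) (x : ℓ²(ι, ℂ))
    (y : κ → ℓ²(γ, ℂ)) (hy : ∀ k g, y k g = x (e (g, k))) (s : Finset ι) :
    ∑ i ∈ s, ‖A (y (e.symm i).2) (e.symm i).1‖ ^ 2 ≤ (‖A‖ * ‖x‖) ^ 2 := by
  classical
  set t : Finset (γ × κ) := s.map e.symm.toEmbedding
  have h1 : ∑ i ∈ s, ‖A (y (e.symm i).2) (e.symm i).1‖ ^ 2
      = ∑ p ∈ t, ‖A (y p.2) p.1‖ ^ 2 := by simp [t]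
  rw [h1]
  calc ∑ p ∈ t, ‖A (y p.2) p.1‖ ^ 2
      ≤ ∑ p ∈ t.image Prod.fst ×ˢ t.image Prod.snd, ‖A (y p.2) p.1‖ ^ 2 :=
        Finset.sum_le_sum_of_subset_of_nonneg Finset.subset_product (fun _ _ _ => by positivity)
    _ = ∑ k ∈ t.image Prod.snd, ∑ g ∈ t.image Prod.fst, ‖A (y k) g‖ ^ 2 :=
        Finset.sum_product_right _ _ _
    _ ≤ ∑ k ∈ t.image Prod.snd, ‖A‖ ^ 2 * ‖y k‖ ^ 2 := by
        refine Finset.sum_le_sum fun k _ => (sum_sq_le _ _).trans ?_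
        rw [← mul_pow]
        exact pow_le_pow_left₀ (norm_nonneg _) (A.le_opNorm _) 2
    _ ≤ (‖A‖ * ‖x‖) ^ 2 := by
        rw [← Finset.mul_sum, mul_pow]
        exact mul_le_mul_of_nonneg_left (sum_slice_sq_le e x y hy _) (by positivity)

/-- The operator `A ⊗ 1`. -/
def tensorOne {ι : Type*} (κ : Type*) (A : Op ι) : Op (ι × κ) :=
  mkOp
    { toFun := fun x p => A (sliceR p.2 x) p.1
      map_add' := fun x y => by ext p; simp
      map_smul' := fun c x => by ext p; simp }
    ‖A‖ (norm_nonneg A)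
    (fun x s => sum_op_slice_sq_le (Equiv.refl (ι × κ)) A x (fun k => sliceR k x)
      (fun _ _ => rfl) s)

/-- The operator `1 ⊗ B`. -/
def oneTensor (ι : Type*) {κ : Type*} (B : Op κ) : Op (ι × κ) :=
  mkOp
    { toFun := fun x p => B (sliceL p.1 x) p.2
      map_add' := fun x y => by ext p; simp
      map_smul' := fun c x => by ext p; simp }
    ‖B‖ (norm_nonneg B)
    (fun x s => sum_op_slice_sq_le (Equiv.prodComm κ ι) B x (fun i => sliceL i x)
      (fun _ _ => rfl) s)

/-- The tensor product `A ⊗ B = (A ⊗ 1) (1 ⊗ B)` of bounded operators. -/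
def tensorOp {ι κ : Type*} (A : Op ι) (B : Op κ) : Op (ι × κ) := tensorOne κ A ∘L oneTensor ι B

/-- The partial trace over the second factor, `∑ₖ (1 ⊗ ⟨k|) A (1 ⊗ |k⟩)`; the series converges
absolutely in operator norm whenever `A` is trace class. -/
def partialTrace {ι κ : Type*} (A : Op (ι × κ)) : Op ι :=
  ∑' k : κ, sliceR k ∘L A ∘L ContinuousLinearMap.adjoint (sliceR k)

/-- `B` is the image of `A` under `Φ ⊗ Id`: with `A = ∑ A_{kl} ⊗ |k⟩⟨l|`, where
`A_{kl} = (1 ⊗ ⟨k|) A (1 ⊗ |l⟩)`, one has `B = ∑ Φ(A_{kl}) ⊗ |k⟩⟨l|`. -/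
def IsTensorIdImage {ι κ : Type*} (Φ : Op ι → Op ι) (A B : Op (ι × κ)) : Prop :=
  ∀ k l : κ, sliceR k ∘L B ∘L ContinuousLinearMap.adjoint (sliceR l)
    = Φ (sliceR k ∘L A ∘L ContinuousLinearMap.adjoint (sliceR l))

open Classical in
/-- `(Φ ⊗ Id)(A)`, the only bounded operator with the prescribed blocks. (It exists for every quantum
channel `Φ` and every trace class operator `A`; the value is `0` if there is none.) -/
def tensorId {ι κ : Type*} (Φ : Op ι → Op ι) (A : Op (ι × κ)) : Op (ι × κ) :=
  if h : ∃ B, IsTensorIdImage Φ A B then h.choose else 0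

/-! ### Entropies and coherent information -/

/-- The operator `-A log₂ A` (continuous functional calculus), for a positive bounded operator `A` on
a Hilbert space. -/
def negMulLog {H : Type*} [NormedAddCommGroup H] [InnerProductSpace ℂ H] [CompleteSpace H]
    (A : H →L[ℂ] H) : H →L[ℂ] H :=
  cfc (fun x : ℝ => -(x * Real.logb 2 x)) A

/-- The von Neumann entropy `S(ρ) = -Tr [ρ log₂ ρ] ∈ [0, ∞]` of a density operator `ρ`; the
trace of the positive operator `-ρ log₂ ρ` is taken in the standard basis. -/
def vonNeumannEntropy {ι : Type*} (ρ : Op ι) : ℝ≥0∞ :=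
  ∑' i : ι, ENNReal.ofReal
    (RCLike.re (inner ℂ (ket i) (negMulLog ρ (ket i))))

/-- The Shannon entropy `H(p) = -∑ᵢ pᵢ log₂ pᵢ ∈ [0, ∞]` of a probability distribution `p`. -/
def shannonEntropy {ι : Type*} (p : ι → ℝ) : ℝ≥0∞ :=
  ∑' i : ι, ENNReal.ofReal (-(p i * Real.logb 2 (p i)))

/-- `|ψ⟩` is a purification of `ρ`, with purifying space `ℓ²(κ, ℂ)`. -/
def IsPurification {ι κ : Type*} (ρ : Op ι) (ψ : ℓ²(ι × κ, ℂ)) : Prop :=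
  partialTrace (proj ψ) = ρ

/-- The coherent information `I_coh(Φ, ρ) = S(Φ(ρ)) - S((Φ ⊗ Id)(|ψ⟩⟨ψ|))` computed with a
purification `ψ` of `ρ`. It takes values in the extended reals, where `⊤ - ⊤ = ⊥`. -/
def coherentInformation {ι κ : Type*} (Φ : Op ι → Op ι) (ρ : Op ι) (ψ : ℓ²(ι × κ, ℂ)) : EReal :=
  (vonNeumannEntropy (Φ ρ) : EReal) - (vonNeumannEntropy (tensorId Φ (proj ψ)) : EReal)

/-! ### Beam splitter and general attenuators -/

/-- Matrix elements `⟨k| a |i⟩` of the annihilation operator: `a |i⟩ = √i |i - 1⟩`. -/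
def annihilation (k i : ℕ) : ℂ := if i = k + 1 then ((√(i : ℝ) : ℝ) : ℂ) else 0

/-- Matrix elements `⟨k| a† |i⟩` of the creation operator. -/
def creation (k i : ℕ) : ℂ := star (annihilation i k)

/-- Matrix elements, in the two-mode Fock basis, of `a₁† a₂ - a₁ a₂†`. -/
def beamSplitterGenerator (p r : ℕ × ℕ) : ℂ :=
  creation p.1 r.1 * annihilation p.2 r.2 - annihilation p.1 r.1 * creation p.2 r.2

/-- `a₁† a₂ - a₁ a₂†` conserves the total photon number; this is its restriction to the
finite-dimensional space spanned by the Fock states `|i⟩|j⟩` with `i + j = M`. -/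
def beamSplitterBlock (M : ℕ) :
    Matrix (Finset.HasAntidiagonal.antidiagonal M) (Finset.HasAntidiagonal.antidiagonal M) ℂ :=
  Matrix.of fun p r => beamSplitterGenerator p.1 r.1

/-- The restriction to `M` photons of `exp [θ (a₁† a₂ - a₁ a₂†)]`. -/
def beamSplitterExp (θ : ℝ) (M : ℕ) :
    Matrix (Finset.HasAntidiagonal.antidiagonal M) (Finset.HasAntidiagonal.antidiagonal M) ℂ :=
  NormedSpace.exp ((θ : ℂ) • beamSplitterBlock M)

theorem beamSplitterBlock_conjTranspose (M : ℕ) :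
    (beamSplitterBlock M).conjTranspose = -beamSplitterBlock M := by
  ext p r
  simp [beamSplitterBlock, beamSplitterGenerator, creation, mul_comm]

theorem beamSplitterExp_conjTranspose_mul (θ : ℝ) (M : ℕ) :
    (beamSplitterExp θ M).conjTranspose * beamSplitterExp θ M = 1 := by
  unfold beamSplitterExp
  rw [← Matrix.exp_conjTranspose, Matrix.conjTranspose_smul, beamSplitterBlock_conjTranspose,
    Complex.star_def, Complex.conj_ofReal, smul_neg, Matrix.exp_neg]
  exact Matrix.nonsing_inv_mul _ ((Matrix.isUnit_iff_isUnit_det _).1 (Matrix.isUnit_exp _))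

theorem sum_sq_beamSplitterExp (θ : ℝ) (M : ℕ) (v : Finset.HasAntidiagonal.antidiagonal M → ℂ) :
    ∑ p, ‖(beamSplitterExp θ M).mulVec v p‖ ^ 2 = ∑ p, ‖v p‖ ^ 2 := by
  have key : ∀ w : Finset.HasAntidiagonal.antidiagonal M → ℂ,
      ((∑ p, ‖w p‖ ^ 2 : ℝ) : ℂ) = dotProduct (star w) w := by
    intro w
    simp [dotProduct, Complex.conj_mul']
  have h : dotProduct (star ((beamSplitterExp θ M).mulVec v)) ((beamSplitterExp θ M).mulVec v)
      = dotProduct (star v) v := by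
    rw [Matrix.star_mulVec, Matrix.dotProduct_mulVec, Matrix.vecMul_vecMul,
      beamSplitterExp_conjTranspose_mul, Matrix.vecMul_one]
  exact_mod_cast (key _).trans (h.trans (key v).symm)

/-- The operator `exp [θ (a₁† a₂ - a₁ a₂†)]` on two modes, the direct sum over `M` of its
restrictions to `M` photons. -/
def beamSplitterRotation (θ : ℝ) : Op (ℕ × ℕ) :=
  mkOp
    { toFun := fun x p => (beamSplitterExp θ (p.1 + p.2)).mulVec (fun r => x r.1)
        ⟨p, Finset.HasAntidiagonal.mem_antidiagonal.2 rfl⟩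
      map_add' := fun x y => by
        ext p
        exact congrFun (Matrix.mulVec_add (beamSplitterExp θ (p.1 + p.2))
          (fun r => x r.1) (fun r => y r.1)) ⟨p, Finset.HasAntidiagonal.mem_antidiagonal.2 rfl⟩
      map_smul' := fun c x => by
        ext p
        exact congrFun (Matrix.mulVec_smul (beamSplitterExp θ (p.1 + p.2)) c
          (fun r => x r.1)) ⟨p, Finset.HasAntidiagonal.mem_antidiagonal.2 rfl⟩ }
    1 zero_le_one
    (fun x s => by
      classical
      set f : ℕ × ℕ → ℂ := fun p => (beamSplitterExp θ (p.1 + p.2)).mulVec (fun r => x r.1)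
        ⟨p, Finset.HasAntidiagonal.mem_antidiagonal.2 rfl⟩ with hf
      have hblock : ∀ M, ∑ p ∈ Finset.HasAntidiagonal.antidiagonal M, ‖f p‖ ^ 2
          = ∑ p ∈ Finset.HasAntidiagonal.antidiagonal M, ‖x p‖ ^ 2 := by
        intro M
        rw [← Finset.sum_coe_sort (Finset.HasAntidiagonal.antidiagonal M) (fun p => ‖f p‖ ^ 2),
          ← Finset.sum_coe_sort (Finset.HasAntidiagonal.antidiagonal M) (fun p => ‖x p‖ ^ 2),
          ← sum_sq_beamSplitterExp θ M (fun r => x r.1)]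
        refine Finset.sum_congr rfl ?_
        rintro ⟨p, hp⟩ -
        obtain rfl := Finset.HasAntidiagonal.mem_antidiagonal.1 hp
        rfl
      have hdisj : ∀ T : Finset ℕ, Set.PairwiseDisjoint (T : Set ℕ)
          (fun M => Finset.HasAntidiagonal.antidiagonal M) := by
        intro T a _ b _ hab
        refine Finset.disjoint_left.2 fun p hp hq => hab ?_
        rw [← Finset.HasAntidiagonal.mem_antidiagonal.1 hp, ← Finset.HasAntidiagonal.mem_antidiagonal.1 hq]
      set T : Finset ℕ := s.image fun p => p.1 + p.2
      have hs : s ⊆ T.biUnion fun M => Finset.HasAntidiagonal.antidiagonal M := by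
        intro p hp
        exact Finset.mem_biUnion.2 ⟨p.1 + p.2, Finset.mem_image_of_mem _ hp,
          Finset.HasAntidiagonal.mem_antidiagonal.2 rfl⟩
      calc ∑ p ∈ s, ‖f p‖ ^ 2
          ≤ ∑ p ∈ T.biUnion fun M => Finset.HasAntidiagonal.antidiagonal M, ‖f p‖ ^ 2 :=
            Finset.sum_le_sum_of_subset_of_nonneg hs (fun _ _ _ => by positivity)
        _ = ∑ p ∈ T.biUnion fun M => Finset.HasAntidiagonal.antidiagonal M, ‖x p‖ ^ 2 := by
            rw [Finset.sum_biUnion (hdisj T), Finset.sum_biUnion (hdisj T)]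
            exact Finset.sum_congr rfl fun M _ => hblock M
        _ ≤ (1 * ‖x‖) ^ 2 := by
            rw [one_mul]
            exact sum_sq_le x _)

/-- The beam splitter of transmissivity `l ∈ [0, 1]`. -/
def beamSplitter (l : ℝ) : Op (ℕ × ℕ) := beamSplitterRotation (Real.arccos (√l))

/-- The general attenuator `Φ_{l,σ}(ρ) = Tr_E [U (ρ ⊗ σ) U†]` of transmissivity `l` and environment
state `σ`, where `U` is the beam splitter of transmissivity `l`. -/
def attenuator (l : ℝ) (σ : Op ℕ) (ρ : Op ℕ) : Op ℕ :=
  partialTrace (beamSplitter l ∘L tensorOp ρ σ ∘L ContinuousLinearMap.adjoint (beamSplitter l))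

/-- The Fock state `|n⟩⟨n|`. -/
def fockState (n : ℕ) : Op ℕ := proj (ket n)

/-- The thermal state with mean photon number `ν ≥ 0`. -/
def thermalState (ν : ℝ) : Op ℕ :=
  (1 / (ν + 1)) • ∑' n : ℕ, (ν / (ν + 1)) ^ n • fockState n

/-! ### The limit distributions -/

/-- The modified Bessel function of the first kind `I_k`, `k ∈ ℕ`. -/
def besselI (k : ℕ) (z : ℝ) : ℝ :=
  (z / 2) ^ k * ∑' m : ℕ, (z / 2) ^ (2 * m) / ((m.factorial : ℝ) * ((k + m).factorial : ℝ))

/-- The Laguerre polynomial `L_k`. -/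
def laguerreL (k : ℕ) (x : ℝ) : ℝ :=
  ∑ m ∈ Finset.range (k + 1), (-1 : ℝ) ^ m / (m.factorial : ℝ) * (k.choose m : ℝ) * x ^ m

/-- The distribution `q(N, c)` on `ℤ`. -/
def qDist (N c : ℝ) (k : ℤ) : ℝ :=
  Real.exp (-c * (2 * N + 1)) * (N / (N + 1)) ^ ((k : ℝ) / 2)
    * besselI k.natAbs (2 * c * √(N * (N + 1)))

/-- The distribution `p(N, c)` on `ℤ`, supported on the non-negative integers. -/
def pDist (N c : ℝ) (k : ℤ) : ℝ :=
  if 0 ≤ k then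
    N ^ k.toNat / (N + 1) ^ (k.toNat + 1) * Real.exp (-c / (N + 1))
      * laguerreL k.toNat (-c / (N * (N + 1)))
  else 0

end Bosonic

end

open scoped ENNReal lp
open Filter Topology

noncomputable section

namespace Bosonic

/-! ### The beam splitter acting on wave functions -/

/-! With input $|m\rangle$ and environment $|n\rangle$ the beam splitter conserves photons, so $e$
photons in the environment output force $m+n-e$ in the signal output. Hence for the thermal input
the signal output is diagonal in the Fock basis, with spectrum `outDist`. The state
$(\Phi\otimes\mathrm{Id})(|\psi\rangle\langle\psi|)$ is $\sum_e|W_e\rangle\langle W_e|$ with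
$W_e=(V_e\otimes1)\psi$ and $V_e=\langle e|U|n\rangle$. The slices of any purification of a diagonal
state are orthogonal, so the $W_e$ are orthogonal, and $\|W_e\|^2$ is the probability `envDist` of
$e$ photons in the environment output. For every $n$ the coherent information is therefore a
difference of two Shannon entropies, $H(\text{outDist})-H(\text{envDist})$
(`vonNeumannEntropy_attenuator`, `vonNeumannEntropy_tensorId`).

When $\lambda=c/n$, the beam splitter acts on the signal in the limit like a displacement with
recorded photon exchange: for $m=0$ the environment output is Binomial$(n,c/n)$, which tends to
Poisson$(c)$, and a ladder recursion in $m$ carries the limit to all $m$ (`tendsto_amplitude`).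
Weighting the limit probabilities by the thermal law gives the joint law `jointDist` of $(m,e)$. Its
marginal in $e$ is $p$ (a Laguerre generating function), and the law of $m-e$ is $q$: its
characteristic function is that of a difference of independent Poisson variables of means $cN$ and
$c(N+1)$, whose weights are Bessel functions (`hasSum_jointDist_left`, `qDist_eq_diffMarginal`).

For the inequality only one-sided continuity of entropy is needed. Pointwise convergence gives lower
semicontinuity for the output term, centred at $n$. The environment term needs upper semicontinuity,
which follows from a bound on the mean photon number uniform in large $n$ (`sum_mul_envDist_le`,
`eventually_shannonEntropy_le`). -/

/-- The annihilation operator of the first mode, acting on arbitrary two-mode wave functions. -/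
def lowerL : (ℕ × ℕ → ℂ) →L[ℂ] (ℕ × ℕ → ℂ) where
  toFun f p := (√((p.1 : ℝ) + 1) : ℝ) * f (p.1 + 1, p.2)
  map_add' f g := by ext p; simp [mul_add]
  map_smul' a f := by ext p; simp; ring
  cont := by fun_prop

/-- The annihilation operator of the second mode. -/
def lowerR : (ℕ × ℕ → ℂ) →L[ℂ] (ℕ × ℕ → ℂ) where
  toFun f p := (√((p.2 : ℝ) + 1) : ℝ) * f (p.1, p.2 + 1)
  map_add' f g := by ext p; simp [mul_add]
  map_smul' a f := by ext p; simp; ring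
  cont := by fun_prop

/-- The creation operator of the first mode. -/
def raiseL : (ℕ × ℕ → ℂ) →L[ℂ] (ℕ × ℕ → ℂ) where
  toFun f p := (√(p.1 : ℝ) : ℝ) * f (p.1 - 1, p.2)
  map_add' f g := by ext p; simp [mul_add]
  map_smul' a f := by ext p; simp; ring
  cont := by fun_prop

/-- The creation operator of the second mode. -/
def raiseR : (ℕ × ℕ → ℂ) →L[ℂ] (ℕ × ℕ → ℂ) where
  toFun f p := (√(p.2 : ℝ) : ℝ) * f (p.1, p.2 - 1)
  map_add' f g := by ext p; simp [mul_add]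
  map_smul' a f := by ext p; simp; ring
  cont := by fun_prop

theorem lowerL_apply (f : ℕ × ℕ → ℂ) (p : ℕ × ℕ) :
    lowerL f p = (√((p.1 : ℝ) + 1) : ℝ) * f (p.1 + 1, p.2) := rfl

theorem lowerR_apply (f : ℕ × ℕ → ℂ) (p : ℕ × ℕ) :
    lowerR f p = (√((p.2 : ℝ) + 1) : ℝ) * f (p.1, p.2 + 1) := rfl

theorem raiseL_apply (f : ℕ × ℕ → ℂ) (p : ℕ × ℕ) :
    raiseL f p = (√(p.1 : ℝ) : ℝ) * f (p.1 - 1, p.2) := rfl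

theorem raiseR_apply (f : ℕ × ℕ → ℂ) (p : ℕ × ℕ) :
    raiseR f p = (√(p.2 : ℝ) : ℝ) * f (p.1, p.2 - 1) := rfl

/-- The generator `a₁† a₂ - a₁ a₂†` acting on arbitrary two-mode wave functions. -/
def waveGenerator : (ℕ × ℕ → ℂ) →L[ℂ] (ℕ × ℕ → ℂ) :=
  raiseL ∘L lowerR - raiseR ∘L lowerL

theorem waveGenerator_apply (f : ℕ × ℕ → ℂ) (p : ℕ × ℕ) :
    waveGenerator f p = (√(p.1 : ℝ) : ℝ) * ((√((p.2 : ℝ) + 1) : ℝ) * f (p.1 - 1, p.2 + 1))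
      - (√(p.2 : ℝ) : ℝ) * ((√((p.1 : ℝ) + 1) : ℝ) * f (p.1 + 1, p.2 - 1)) := by
  simp [waveGenerator, raiseL_apply, raiseR_apply, lowerL_apply, lowerR_apply]

theorem ofReal_sqrt_mul_self (n : ℕ) : ((√(n : ℝ) : ℝ) : ℂ) * ((√(n : ℝ) : ℝ) : ℂ) = n := by
  rw [← Complex.ofReal_mul, Real.mul_self_sqrt (by positivity)]; simp

theorem ofReal_sqrt_succ_mul_self (n : ℕ) :
    ((√((n : ℝ) + 1) : ℝ) : ℂ) * ((√((n : ℝ) + 1) : ℝ) : ℂ) = n + 1 := by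
  rw [← Complex.ofReal_mul, Real.mul_self_sqrt (by positivity)]; simp

/-- The commutators $[G,a_1]=-a_2$ and $[G,a_2]=a_1$, together with $[G,a_1^\dagger]=-a_2^\dagger$
and $[G,a_2^\dagger]=a_1^\dagger$ below: $G$ acts on each pair as an infinitesimal rotation.
Truncated subtraction at index $0$ is harmless because it always comes with the factor $\sqrt0$. -/
theorem waveGenerator_lowerL (f : ℕ × ℕ → ℂ) :
    waveGenerator (lowerL f) = lowerL (waveGenerator f) - lowerR f := by
  ext ⟨i, j⟩
  have hi := ofReal_sqrt_mul_self i
  have hi' := ofReal_sqrt_succ_mul_self i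
  rcases i with _ | i
  · simp only [waveGenerator_apply, lowerL_apply, lowerR_apply, Pi.sub_apply]
    simp
  · simp only [waveGenerator_apply, lowerL_apply, lowerR_apply, Pi.sub_apply, Nat.add_sub_cancel]
    push_cast at hi hi' ⊢
    linear_combination (f (i + 1, j + 1) * (√((j : ℝ) + 1) : ℝ)) * (hi - hi')

theorem waveGenerator_lowerR (f : ℕ × ℕ → ℂ) :
    waveGenerator (lowerR f) = lowerR (waveGenerator f) + lowerL f := by
  ext ⟨i, j⟩
  have hi := ofReal_sqrt_mul_self j
  have hi' := ofReal_sqrt_succ_mul_self j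
  rcases j with _ | j
  · simp only [waveGenerator_apply, lowerL_apply, lowerR_apply, Pi.add_apply]
    simp
  · simp only [waveGenerator_apply, lowerL_apply, lowerR_apply, Pi.add_apply, Nat.add_sub_cancel]
    push_cast at hi hi' ⊢
    linear_combination (f (i + 1, j + 1) * (√((i : ℝ) + 1) : ℝ)) * (hi' - hi)

theorem waveGenerator_raiseL (f : ℕ × ℕ → ℂ) :
    waveGenerator (raiseL f) = raiseL (waveGenerator f) - raiseR f := by
  ext ⟨i, j⟩
  have hi := ofReal_sqrt_mul_self i
  have hi' := ofReal_sqrt_succ_mul_self i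
  rcases i with _ | i
  · simp only [waveGenerator_apply, raiseL_apply, raiseR_apply, Pi.sub_apply]
    simp
  · simp only [waveGenerator_apply, raiseL_apply, raiseR_apply, Pi.sub_apply, Nat.add_sub_cancel]
    push_cast at hi hi' ⊢
    linear_combination (f (i + 1, j - 1) * (√(j : ℝ) : ℝ)) * (hi - hi')

theorem waveGenerator_raiseR (f : ℕ × ℕ → ℂ) :
    waveGenerator (raiseR f) = raiseR (waveGenerator f) + raiseL f := by
  ext ⟨i, j⟩
  have hi := ofReal_sqrt_mul_self j
  have hi' := ofReal_sqrt_succ_mul_self j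
  rcases j with _ | j
  · simp only [waveGenerator_apply, raiseL_apply, raiseR_apply, Pi.add_apply]
    simp
  · simp only [waveGenerator_apply, raiseL_apply, raiseR_apply, Pi.add_apply, Nat.add_sub_cancel]
    push_cast at hi hi' ⊢
    linear_combination (f (i - 1, j + 1) * (√(i : ℝ) : ℝ)) * (hi' - hi)

/-- Links the finite blocks with an operator on all wave functions. The latter is needed because the
ladder operators change the total photon number and so leave every single block. -/
theorem beamSplitterBlock_mulVec (M : ℕ) (f : ℕ × ℕ → ℂ) :
    (beamSplitterBlock M).mulVec (fun r => f r.1) = fun r => waveGenerator f r.1 := by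
  ext ⟨⟨i, j⟩, hp⟩
  rw [Finset.HasAntidiagonal.mem_antidiagonal] at hp
  simp only at hp
  have h1 : ∑ r ∈ Finset.HasAntidiagonal.antidiagonal M,
      creation i r.1 * annihilation j r.2 * f r
        = (√(i : ℝ) : ℝ) * ((√((j : ℝ) + 1) : ℝ) * f (i - 1, j + 1)) := by
    rcases i with _ | i
    · simp [creation, annihilation]
    · rw [Finset.sum_eq_single (i, j + 1)]
      · simp [creation, annihilation]; ring
      · rintro ⟨a, b⟩ - hne
        simp only [creation, annihilation]
        by_cases h1 : i + 1 = a + 1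
        · rw [if_neg (fun h2 : b = j + 1 => hne (Prod.ext (by simpa using h1.symm) h2))]
          simp
        · simp only [if_neg h1, star_zero, zero_mul]
      · intro h
        exact absurd (Finset.HasAntidiagonal.mem_antidiagonal.2 (by simp; omega)) h
  have h2 : ∑ r ∈ Finset.HasAntidiagonal.antidiagonal M,
      annihilation i r.1 * creation j r.2 * f r
        = (√(j : ℝ) : ℝ) * ((√((i : ℝ) + 1) : ℝ) * f (i + 1, j - 1)) := by
    rcases j with _ | j
    · simp [creation, annihilation]
    · rw [Finset.sum_eq_single (i + 1, j)]
      · simp [creation, annihilation]; ring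
      · rintro ⟨a, b⟩ - hne
        simp only [creation, annihilation]
        by_cases h1 : j + 1 = b + 1
        · rw [if_neg (fun h2 : a = i + 1 => hne (Prod.ext h2 (by simpa using h1.symm)))]
          simp
        · simp only [if_neg h1, star_zero, zero_mul, mul_zero]
      · intro h
        exact absurd (Finset.HasAntidiagonal.mem_antidiagonal.2 (by simp; omega)) h
  rw [waveGenerator_apply, ← h1, ← h2, ← Finset.sum_sub_distrib, ← Finset.sum_coe_sort]
  simp only [Matrix.mulVec, dotProduct, beamSplitterBlock, Matrix.of_apply, beamSplitterGenerator]
  exact Finset.sum_congr rfl fun r _ => by ring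

/-- The beam splitter acting on arbitrary two-mode wave functions. -/
def waveEvolution (θ : ℝ) (f : ℕ × ℕ → ℂ) (p : ℕ × ℕ) : ℂ :=
  (beamSplitterExp θ (p.1 + p.2)).mulVec (fun r => f r.1)
    ⟨p, Finset.HasAntidiagonal.mem_antidiagonal.2 rfl⟩

open scoped Nat in
theorem hasSum_exp_mulVec {m : Type*} [Fintype m] [DecidableEq m] (A : Matrix m m ℂ) (v : m → ℂ)
    (i : m) : HasSum (fun k : ℕ => ((k ! : ℂ)⁻¹) * ((A ^ k).mulVec v) i)
      ((NormedSpace.exp A).mulVec v i) := by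
  -- Any algebra norm serves here; it only provides convergence of the exponential series.
  let _ : NormedRing (Matrix m m ℂ) := Matrix.linftyOpNormedRing
  let _ : NormedAlgebra ℂ (Matrix m m ℂ) := Matrix.linftyOpNormedAlgebra
  have h := NormedSpace.exp_series_hasSum_exp' (𝕂 := ℂ) A
  have hc : Continuous fun B : Matrix m m ℂ => B.mulVec v i := by fun_prop
  have := h.map (({ toFun := fun B : Matrix m m ℂ => B.mulVec v i
                    map_zero' := by simp
                    map_add' := fun B C => by simp [Matrix.add_mulVec] } : Matrix m m ℂ →+ ℂ)) hc
  convert! this using 1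
  ext k
  simp [Matrix.smul_mulVec]

theorem blockShift_pow_mulVec (M k : ℕ) (z : ℂ) (f : ℕ × ℕ → ℂ) :
    ((beamSplitterBlock M + z • (1 : Matrix _ _ ℂ)) ^ k).mulVec (fun r => f r.1)
      = fun r => ((waveGenerator + z • 1) ^ k) f r.1 := by
  induction k with
  | zero => simp
  | succ k ih =>
    rw [pow_succ', ← Matrix.mulVec_mulVec, ih, Matrix.add_mulVec, beamSplitterBlock_mulVec]
    ext r
    simp [pow_succ', Matrix.smul_mulVec]

theorem exp_add_smul_one {m : Type*} [Fintype m] [DecidableEq m] (A : Matrix m m ℂ) (z : ℂ) :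
    NormedSpace.exp (A + z • (1 : Matrix m m ℂ)) = Complex.exp z • NormedSpace.exp A := by
  rw [Matrix.exp_add_of_commute _ _ (by simp [Commute, SemiconjBy])]
  have : NormedSpace.exp (z • (1 : Matrix m m ℂ)) = Complex.exp z • 1 := by
    rw [← Matrix.diagonal_one, ← Matrix.diagonal_smul, Matrix.exp_diagonal, ← Matrix.diagonal_smul]
    congr 1
    ext i
    simp [NormedSpace.exp, Complex.exp_eq_exp_ℂ]
  rw [this]
  simp

-- Each coordinate lies in one finite block, so coordinatewise convergence on the full function
-- space reduces to the matrix exponential. The scalar shift $z$ commutes with everything and costs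
-- only the factor $e^{\theta z}$.
open scoped Nat in
theorem hasSum_waveEvolution (θ : ℝ) (z : ℂ) (f : ℕ × ℕ → ℂ) :
    HasSum (fun k : ℕ => ((k ! : ℂ)⁻¹ * (θ : ℂ) ^ k) • ((waveGenerator + z • 1) ^ k) f)
      (Complex.exp (θ * z) • waveEvolution θ f) := by
  rw [Pi.hasSum]
  intro p
  have h := hasSum_exp_mulVec ((θ : ℂ) • (beamSplitterBlock (p.1 + p.2) + z • 1)) (fun r => f r.1)
    ⟨p, Finset.HasAntidiagonal.mem_antidiagonal.2 rfl⟩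
  have e : NormedSpace.exp ((θ : ℂ) • (beamSplitterBlock (p.1 + p.2) + z • 1))
      = Complex.exp (θ * z) • beamSplitterExp θ (p.1 + p.2) := by
    rw [smul_add, smul_smul, exp_add_smul_one]; rfl
  rw [e, Matrix.smul_mulVec] at h
  convert! h using 1
  ext k
  rw [smul_pow, Matrix.smul_mulVec, blockShift_pow_mulVec]
  simp [mul_assoc]

/-- From $GZ=Z(G+z)$ one gets $G^kZ=Z(G+z)^k$; summing the exponential series, with $Z$ continuous
for coordinatewise convergence, gives $e^{\theta G}Z=e^{\theta z}Ze^{\theta G}$. -/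
theorem waveEvolution_intertwine_aux (θ : ℝ) (z : ℂ) (Z : (ℕ × ℕ → ℂ) →L[ℂ] (ℕ × ℕ → ℂ))
    (hZ : waveGenerator ∘L Z = Z ∘L (waveGenerator + z • 1)) (f : ℕ × ℕ → ℂ) :
    waveEvolution θ (Z f) = Complex.exp (θ * z) • Z (waveEvolution θ f) := by
  have hpow : ∀ k g, (waveGenerator ^ k) (Z g) = Z (((waveGenerator + z • 1) ^ k) g) := by
    intro k
    induction k with
    | zero => simp
    | succ k ih =>
      intro g
      rw [pow_succ, pow_succ]
      have := congrArg (fun A => A g) hZ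
      simp only [ContinuousLinearMap.comp_apply] at this
      exact (congrArg _ this).trans (ih _)
  have h1 := hasSum_waveEvolution θ 0 (Z f)
  have h2 := Z.hasSum (hasSum_waveEvolution θ z f)
  rw [mul_zero, Complex.exp_zero, one_smul] at h1
  have h0 : waveGenerator + (0 : ℂ) • 1 = waveGenerator := by ext g p; simp
  simp only [h0, hpow] at h1
  simp only [map_smul] at h2
  exact h1.unique h2

/-- A pair of operators rotated into each other by the generator is rotated by the beam splitter. -/
theorem waveEvolution_intertwine (K L : (ℕ × ℕ → ℂ) →L[ℂ] (ℕ × ℕ → ℂ))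
    (hK : ∀ f, waveGenerator (K f) = K (waveGenerator f) - L f)
    (hL : ∀ f, waveGenerator (L f) = L (waveGenerator f) + K f) (θ : ℝ) (f : ℕ × ℕ → ℂ) :
    waveEvolution θ (K f)
      = (Real.cos θ : ℂ) • K (waveEvolution θ f) - (Real.sin θ : ℂ) • L (waveEvolution θ f) ∧
    waveEvolution θ (L f)
      = (Real.sin θ : ℂ) • K (waveEvolution θ f) + (Real.cos θ : ℂ) • L (waveEvolution θ f) := by
  have hadd : ∀ g h : ℕ × ℕ → ℂ, waveEvolution θ (g + h) = waveEvolution θ g + waveEvolution θ h := by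
    intro g h
    ext p
    exact congrFun (Matrix.mulVec_add (beamSplitterExp θ (p.1 + p.2))
          (fun r => g r.1) (fun r => h r.1)) _
  have hsmul : ∀ (a : ℂ) (g : ℕ × ℕ → ℂ), waveEvolution θ (a • g) = a • waveEvolution θ g := by
    intro a g
    ext p
    exact congrFun (Matrix.mulVec_smul (beamSplitterExp θ (p.1 + p.2)) a (fun r => g r.1)) _
  -- The combinations $K\pm iL$ diagonalise the commutator with $G$: $[G,K+zL]=z(K+zL)$ exactly when
  -- $z^2=-1$. Adding and subtracting the two cases yields cosine and sine.
  have key : ∀ z : ℂ, z * z = -1 → waveEvolution θ (K f) + z • waveEvolution θ (L f)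
      = Complex.exp (θ * z) • (K (waveEvolution θ f) + z • L (waveEvolution θ f)) := by
    intro z hz
    have := waveEvolution_intertwine_aux θ z (K + z • L) (by
      ext g p
      simp only [ContinuousLinearMap.comp_apply, add_apply, map_add, map_smul,
        smul_apply, hK, hL, one_apply_eq_self, Pi.add_apply,
        Pi.sub_apply, Pi.smul_apply, smul_eq_mul]
      linear_combination (- (L g p)) * hz) f
    simpa [hadd, hsmul] using this
  have h1 := key Complex.I (by simp)
  have h2 := key (-Complex.I) (by simp)
  rw [Complex.exp_mul_I] at h1
  rw [mul_neg, ← neg_mul, Complex.exp_mul_I, Complex.cos_neg, Complex.sin_neg] at h2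
  push_cast
  constructor
  · ext p
    have e1 := congrFun h1 p
    have e2 := congrFun h2 p
    simp only [Pi.add_apply, Pi.sub_apply, Pi.smul_apply, smul_eq_mul] at e1 e2 ⊢
    linear_combination (1/2) * e1 + (1/2) * e2 + Complex.sin θ * (L (waveEvolution θ f) p) * Complex.I_mul_I
  · ext p
    have e1 := congrFun h1 p
    have e2 := congrFun h2 p
    simp only [Pi.add_apply, Pi.smul_apply, smul_eq_mul] at e1 e2 ⊢
    linear_combination (-Complex.I/2) * e1 + (Complex.I/2) * e2 + (waveEvolution θ (L f) p
      - Complex.sin θ * K (waveEvolution θ f) p - Complex.cos θ * L (waveEvolution θ f) p) * Complex.I_mul_I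

/-! ### Fock space amplitudes of the beam splitter -/

/-- The amplitude `⟨p| exp [θ (a₁† a₂ - a₁ a₂†)] |m, n⟩`. -/
def amplitude (θ : ℝ) (m n : ℕ) : ℕ × ℕ → ℂ := waveEvolution θ (Pi.single (m, n) 1)

theorem amplitude_eq_zero {θ : ℝ} {m n : ℕ} {p : ℕ × ℕ} (h : p.1 + p.2 ≠ m + n) :
    amplitude θ m n p = 0 := by
  simp only [amplitude, waveEvolution, Matrix.mulVec, dotProduct]
  refine Finset.sum_eq_zero fun r _ => ?_
  have hr := Finset.HasAntidiagonal.mem_antidiagonal.1 r.2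
  rw [Pi.single_apply, if_neg, mul_zero]
  intro h'
  rw [h'] at hr
  exact h hr.symm

theorem ket_eq_single {ι : Type*} [DecidableEq ι] (i : ι) :
    (ket i : ι → ℂ) = Pi.single i 1 := by
  ext j
  simp only [ket, lp.single_apply, Pi.single_apply]
  by_cases h : j = i <;> simp [h]

theorem ket_apply {ι : Type*} [DecidableEq ι] (i j : ι) : ket i j = if j = i then 1 else 0 := by
  rw [ket_eq_single, Pi.single_apply]

theorem norm_ket {ι : Type*} (i : ι) : ‖ket i‖ = 1 := by
  classical
  simp [ket, lp.norm_single]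

theorem beamSplitterRotation_ket (θ : ℝ) (m n : ℕ) (p : ℕ × ℕ) :
    beamSplitterRotation θ (ket (m, n)) p = amplitude θ m n p := by
  change waveEvolution θ (ket (m, n)) p = _
  rw [ket_eq_single]
  rfl

theorem norm_mkOp_le {ι κ : Type*} (f : ℓ²(ι, ℂ) →ₗ[ℂ] (κ → ℂ)) (C : ℝ) (hC : 0 ≤ C)
    (h : ∀ x, ∀ s : Finset κ, ∑ k ∈ s, ‖f x k‖ ^ 2 ≤ (C * ‖x‖) ^ 2) : ‖mkOp f C hC h‖ ≤ C :=
  LinearMap.mkContinuous_norm_le _ hC _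

theorem norm_beamSplitterRotation_le (θ : ℝ) (x : ℓ²(ℕ × ℕ, ℂ)) :
    ‖beamSplitterRotation θ x‖ ≤ ‖x‖ :=
  (ContinuousLinearMap.le_opNorm _ _).trans
    (mul_le_of_le_one_left (norm_nonneg _) (norm_mkOp_le _ _ _ _))

theorem sum_sq_amplitude_le (θ : ℝ) (m n : ℕ) (s : Finset (ℕ × ℕ)) :
    ∑ p ∈ s, ‖amplitude θ m n p‖ ^ 2 ≤ 1 := by
  have h := sum_sq_le (beamSplitterRotation θ (ket (m, n))) s
  simp only [beamSplitterRotation_ket] at h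
  refine h.trans ?_
  have := norm_beamSplitterRotation_le θ (ket (m, n))
  rw [norm_ket] at this
  exact pow_le_one₀ (norm_nonneg _) this

theorem lowerL_single (m n : ℕ) :
    lowerL (Pi.single (m, n) 1) = ((√(m : ℝ) : ℝ) : ℂ) • Pi.single (m - 1, n) 1 := by
  ext ⟨a, b⟩
  rcases m with _ | m
  · simp [lowerL_apply]
  · by_cases h : a = m <;> simp [lowerL_apply, Pi.single_apply, h]

theorem lowerR_single (m n : ℕ) :
    lowerR (Pi.single (m, n) 1) = ((√(n : ℝ) : ℝ) : ℂ) • Pi.single (m, n - 1) 1 := by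
  ext ⟨a, b⟩
  rcases n with _ | n
  · simp [lowerR_apply]
  · by_cases h : b = n <;> simp [lowerR_apply, Pi.single_apply, h]

theorem raiseL_single (m n : ℕ) :
    raiseL (Pi.single (m, n) 1) = ((√((m : ℝ) + 1) : ℝ) : ℂ) • Pi.single (m + 1, n) 1 := by
  ext ⟨a, b⟩
  rcases a with _ | a
  · simp [raiseL_apply]
  · by_cases h : a = m <;> simp [raiseL_apply, Pi.single_apply, h]

theorem waveEvolution_smul (θ : ℝ) (a : ℂ) (f : ℕ × ℕ → ℂ) :
    waveEvolution θ (a • f) = a • waveEvolution θ f := by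
  ext p
  exact congrFun (Matrix.mulVec_smul (beamSplitterExp θ (p.1 + p.2)) a (fun r => f r.1)) _

/-- The rotation of $(a_1,a_2)$ solved for $a_2U=\cos\theta\,Ua_2-\sin\theta\,Ua_1$, then evaluated
on $|m,n\rangle$. -/
theorem amplitude_lowerR (θ : ℝ) (m n i j : ℕ) :
    (√((j : ℝ) + 1) : ℝ) * amplitude θ m n (i, j + 1)
      = (Real.cos θ : ℂ) * ((√(n : ℝ) : ℝ) * amplitude θ m (n - 1) (i, j))
        - (Real.sin θ : ℂ) * ((√(m : ℝ) : ℝ) * amplitude θ (m - 1) n (i, j)) := by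
  have h := waveEvolution_intertwine _ _ waveGenerator_lowerL waveGenerator_lowerR θ
    (Pi.single (m, n) 1)
  rw [lowerL_single, lowerR_single, waveEvolution_smul, waveEvolution_smul] at h
  have h1 := congrFun h.1 (i, j)
  have h2 := congrFun h.2 (i, j)
  have hsc : (Real.sin θ : ℂ) ^ 2 + (Real.cos θ : ℂ) ^ 2 = 1 := by
    exact_mod_cast Real.sin_sq_add_cos_sq θ
  simp only [Pi.add_apply, Pi.sub_apply, Pi.smul_apply, smul_eq_mul, lowerL_apply,
    lowerR_apply] at h1 h2
  simp only [amplitude]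
  linear_combination (Real.sin θ : ℂ) * h1 - (Real.cos θ : ℂ) * h2
    - ((√((j : ℝ) + 1) : ℝ) * waveEvolution θ (Pi.single (m, n) 1) (i, j + 1)) * hsc

theorem amplitude_lowerL (θ : ℝ) (m n i j : ℕ) :
    (√((i : ℝ) + 1) : ℝ) * amplitude θ m n (i + 1, j)
      = (Real.cos θ : ℂ) * ((√(m : ℝ) : ℝ) * amplitude θ (m - 1) n (i, j))
        + (Real.sin θ : ℂ) * ((√(n : ℝ) : ℝ) * amplitude θ m (n - 1) (i, j)) := by
  have h := waveEvolution_intertwine _ _ waveGenerator_lowerL waveGenerator_lowerR θ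
    (Pi.single (m, n) 1)
  rw [lowerL_single, lowerR_single, waveEvolution_smul, waveEvolution_smul] at h
  have h1 := congrFun h.1 (i, j)
  have h2 := congrFun h.2 (i, j)
  have hsc : (Real.sin θ : ℂ) ^ 2 + (Real.cos θ : ℂ) ^ 2 = 1 := by
    exact_mod_cast Real.sin_sq_add_cos_sq θ
  simp only [Pi.add_apply, Pi.sub_apply, Pi.smul_apply, smul_eq_mul, lowerL_apply,
    lowerR_apply] at h1 h2
  simp only [amplitude]
  linear_combination - (Real.cos θ : ℂ) * h1 - (Real.sin θ : ℂ) * h2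
    - ((√((i : ℝ) + 1) : ℝ) * waveEvolution θ (Pi.single (m, n) 1) (i + 1, j)) * hsc

theorem amplitude_succ (θ : ℝ) (m n i j : ℕ) :
    (√((m : ℝ) + 1) : ℝ) * amplitude θ (m + 1) n (i, j)
      = (Real.cos θ : ℂ) * ((√(i : ℝ) : ℝ) * amplitude θ m n (i - 1, j))
        - (Real.sin θ : ℂ) * ((√(j : ℝ) : ℝ) * amplitude θ m n (i, j - 1)) := by
  have h := (waveEvolution_intertwine _ _ waveGenerator_raiseL waveGenerator_raiseR θ
    (Pi.single (m, n) 1)).1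
  rw [raiseL_single, waveEvolution_smul] at h
  exact congrFun h (i, j)

theorem amplitude_zero_zero (θ : ℝ) : amplitude θ 0 0 (0, 0) = 1 := by
  have h := (Pi.hasSum.1 (hasSum_waveEvolution θ 0 (Pi.single (0, 0) 1))) (0, 0)
  have h0 : waveGenerator + (0 : ℂ) • 1 = waveGenerator := by ext g p; simp
  have h1 : waveGenerator (Pi.single (0, 0) 1) = 0 := by
    ext ⟨a, b⟩
    simp [waveGenerator_apply]
  rw [h0] at h
  have h2 := hasSum_single (f := fun k : ℕ => (((k.factorial : ℂ)⁻¹ * (θ : ℂ) ^ k) • (waveGenerator ^ k)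
    (Pi.single (0, 0) 1)) (0, 0)) 0 (by
      intro k hk
      obtain ⟨k, rfl⟩ := Nat.exists_eq_succ_of_ne_zero hk
      have : (waveGenerator ^ (k + 1)) (Pi.single (0, 0) 1) = (waveGenerator ^ k) 0 := by
        rw [pow_succ]; exact congrArg _ h1
      simp [this])
  have := h.unique h2
  simpa [amplitude] using this

/-- With vacuum in the first mode the $n$ photons are split independently, so the output is
binomial. The lowering recursions lose their $m$ term: `amplitude_lowerL` builds up $i$ at $j=0$,
and `amplitude_lowerR` then builds up $j$. -/
theorem amplitude_zero_left (θ : ℝ) (i j : ℕ) :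
    amplitude θ 0 (i + j) (i, j)
      = ((√((i + j).choose j : ℝ) * Real.sin θ ^ i * Real.cos θ ^ j : ℝ) : ℂ) := by
  induction j with
  | zero =>
    induction i with
    | zero => simp [amplitude_zero_zero]
    | succ i ih =>
      have h := amplitude_lowerL θ 0 (i + 1) i 0
      have hne : ((√((i : ℝ) + 1) : ℝ) : ℂ) ≠ 0 := by
        exact_mod_cast (Real.sqrt_pos.2 (by positivity)).ne'
      apply mul_left_cancel₀ hne
      simp only [add_zero] at h ih ⊢
      rw [h]
      simp [ih]
      ring
  | succ j ih =>
    have h := amplitude_lowerR θ 0 (i + j + 1) i j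
    have hne : ((√((j : ℝ) + 1) : ℝ) : ℂ) ≠ 0 := by
      exact_mod_cast (Real.sqrt_pos.2 (by positivity)).ne'
    apply mul_left_cancel₀ hne
    rw [← add_assoc, h]
    simp only [Nat.cast_zero, Real.sqrt_zero, Complex.ofReal_zero, zero_mul, mul_zero, sub_zero,
      Nat.add_sub_cancel, ih]
    have e : √((j : ℝ) + 1) * √((i + j + 1).choose (j + 1) : ℝ)
        = √((i + j + 1 : ℕ) : ℝ) * √((i + j).choose j : ℝ) := by
      rw [← Real.sqrt_mul (by positivity), ← Real.sqrt_mul (by positivity)]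
      congr 1
      have := Nat.add_one_mul_choose_eq (i + j) j
      rw [mul_comm]
      exact_mod_cast this.symm
    rw [← Complex.ofReal_mul, ← Complex.ofReal_mul, ← Complex.ofReal_mul]
    congr 1
    linear_combination - Real.sin θ ^ i * Real.cos θ ^ (j + 1) * e

/-! ### Transition probabilities: normalisation and first moment. -/

/-- Transition probability from `m` photons in the first input mode, and `n` in the second one, to
`e` photons in the second output mode. -/
def transProb (θ : ℝ) (n m e : ℕ) : ℝ :=
  if e ≤ m + n then ‖amplitude θ m n (m + n - e, e)‖ ^ 2 else 0

theorem transProb_nonneg (θ : ℝ) (n m e : ℕ) : 0 ≤ transProb θ n m e := by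
  unfold transProb; split_ifs <;> positivity

theorem transProb_le_one (θ : ℝ) (n m e : ℕ) : transProb θ n m e ≤ 1 := by
  unfold transProb
  split_ifs
  · simpa using sum_sq_amplitude_le θ m n {(m + n - e, e)}
  · exact zero_le_one

theorem sum_transProb_le (θ : ℝ) (n m : ℕ) (s : Finset ℕ) : ∑ e ∈ s, transProb θ n m e ≤ 1 := by
  refine le_trans ?_ (sum_sq_amplitude_le θ m n (s.image fun e => (m + n - e, e)))
  rw [Finset.sum_image (fun a _ b _ h => (Prod.ext_iff.1 h).2)]
  refine Finset.sum_le_sum fun e _ => ?_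
  unfold transProb
  split_ifs
  · exact le_rfl
  · positivity

/-- The left side is part of $\|a_2U|m,n\rangle\|^2$, with $a_2U=\cos\theta\,Ua_2-\sin\theta\,Ua_1$.
The factors $2$ come from $(x+y)^2\le2x^2+2y^2$. What matters is that $\cos^2\theta\cdot n=c$ for
the angles used later, so the bound does not grow with $n$. -/
theorem sum_mul_transProb_le (θ : ℝ) (n m : ℕ) (s : Finset ℕ) :
    ∑ e ∈ s, (e : ℝ) * transProb θ n m e ≤ 2 * (Real.cos θ ^ 2 * n) + 2 * m := by
  have key : ∀ e : ℕ, (e : ℝ) * transProb θ n m e ≤ if 1 ≤ e then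
      2 * (Real.cos θ ^ 2 * n) * ‖amplitude θ m (n - 1) (m + n - e, e - 1)‖ ^ 2
        + 2 * m * ‖amplitude θ (m - 1) n (m + n - e, e - 1)‖ ^ 2 else 0 := by
    rintro (_ | e)
    · simp
    · unfold transProb
      split_ifs
      · have h := amplitude_lowerR θ m n (m + n - (e + 1)) e
        have h1 : ((e + 1 : ℕ) : ℝ) * ‖amplitude θ m n (m + n - (e + 1), e + 1)‖ ^ 2
            = ‖((√((e : ℝ) + 1) : ℝ) : ℂ) * amplitude θ m n (m + n - (e + 1), e + 1)‖ ^ 2 := by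
          rw [norm_mul, mul_pow, Complex.norm_real, Real.norm_eq_abs, sq_abs,
            Real.sq_sqrt (by positivity)]
          simp
        rw [h1, h, Nat.add_sub_cancel]
        set A := amplitude θ m (n - 1) (m + n - (e + 1), e)
        set B := amplitude θ (m - 1) n (m + n - (e + 1), e)
        have h2 := norm_sub_le ((Real.cos θ : ℂ) * ((√(n : ℝ) : ℝ) * A))
          ((Real.sin θ : ℂ) * ((√(m : ℝ) : ℝ) * B))
        have h3 : ‖(Real.cos θ : ℂ) * ((√(n : ℝ) : ℝ) * A)‖ ^ 2 = Real.cos θ ^ 2 * n * ‖A‖ ^ 2 := by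
          rw [norm_mul, norm_mul, Complex.norm_real, Complex.norm_real, mul_pow, mul_pow,
            Real.norm_eq_abs, Real.norm_eq_abs, sq_abs, sq_abs, Real.sq_sqrt (by positivity)]
          ring
        have h4 : ‖(Real.sin θ : ℂ) * ((√(m : ℝ) : ℝ) * B)‖ ^ 2 ≤ m * ‖B‖ ^ 2 := by
          rw [norm_mul, norm_mul, Complex.norm_real, Complex.norm_real, mul_pow, mul_pow,
            Real.norm_eq_abs, Real.norm_eq_abs, sq_abs, sq_abs, Real.sq_sqrt (by positivity)]
          exact mul_le_of_le_one_left (by positivity) (Real.sin_sq_le_one θ)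
        have h5 := pow_le_pow_left₀ (norm_nonneg _) h2 2
        have h6 := add_pow_le (norm_nonneg ((Real.cos θ : ℂ) * ((√(n : ℝ) : ℝ) * A)))
          (norm_nonneg ((Real.sin θ : ℂ) * ((√(m : ℝ) : ℝ) * B))) 2
        rw [show (2 : ℝ) ^ (2 - 1) = 2 by norm_num] at h6
        linarith
      · omega
      · simp; positivity
      · omega
  refine (Finset.sum_le_sum fun e _ => key e).trans ?_
  rw [← Finset.sum_filter, Finset.sum_add_distrib, ← Finset.mul_sum, ← Finset.mul_sum]
  -- Restricting to $e\ge1$ makes $e\mapsto e-1$ injective, so these are distinct coordinates of a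
  -- vector of norm at most $1$.
  have hle : ∀ m' n', ∑ e ∈ s with 1 ≤ e, ‖amplitude θ m' n' (m + n - e, e - 1)‖ ^ 2 ≤ 1 := by
    intro m' n'
    refine le_trans ?_ (sum_sq_amplitude_le θ m' n'
      ((s.filter (1 ≤ ·)).image fun e => (m + n - e, e - 1)))
    rw [Finset.sum_image]
    intro a ha b hb h
    have := (Prod.ext_iff.1 h).2
    simp at ha hb this
    omega
  refine add_le_add (mul_le_of_le_one_right (by positivity) (hle _ _))
    (mul_le_of_le_one_right (by positivity) (hle _ _))

/-! ### The limit $n\to\infty$ with $\cos^2\theta=c/n$. -/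

/-- Matrix element `⟨j| exp [√c (a - a†)] |m⟩` (up to a phase). -/
def displacement (c : ℝ) : ℕ → ℕ → ℝ
  | 0, j => √(Real.exp (-c) * c ^ j / (j.factorial : ℝ))
  | m + 1, j => (√c * displacement c m j - √(j : ℝ) * displacement c m (j - 1)) / √((m : ℝ) + 1)

theorem eventually_cos_sin_arccos (c : ℝ) (hc : 0 < c) : ∀ᶠ n : ℕ in atTop,
    0 < n ∧ c / n ≤ 1 ∧ Real.cos (Real.arccos √(c / n)) = √(c / n) ∧
      Real.sin (Real.arccos √(c / n)) = √(1 - c / n) := by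
  obtain ⟨n₀, hn₀⟩ := exists_nat_ge c
  filter_upwards [eventually_ge_atTop n₀, eventually_gt_atTop 0] with n hn h0
  have hn' : (0 : ℝ) < n := by exact_mod_cast h0
  have h1 : c / n ≤ 1 := (div_le_one hn').2 (hn₀.trans (by exact_mod_cast hn))
  refine ⟨h0, h1, Real.cos_arccos ?_ (Real.sqrt_le_one.2 h1), ?_⟩
  · linarith [Real.sqrt_nonneg (c / n)]
  · rw [Real.sin_arccos, Real.sq_sqrt (by positivity)]

theorem sqrt_pow_eq {x : ℝ} (hx : 0 ≤ x) (k : ℕ) : √(x ^ k) = √x ^ k := by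
  induction k with
  | zero => simp
  | succ k ih => rw [pow_succ, pow_succ, Real.sqrt_mul (by positivity), ih]

/-- Induction on $m$. The vacuum case is the Poisson limit of the binomial law; the step passes to
the limit in `amplitude_succ`, which becomes the recursion defining `displacement`. -/
theorem tendsto_amplitude (c : ℝ) (hc : 0 < c) (m j : ℕ) :
    Tendsto (fun n : ℕ => amplitude (Real.arccos √(c / n)) m n (m + n - j, j)) atTop
      (𝓝 (displacement c m j : ℂ)) := by
  have hdiv : Tendsto (fun n : ℕ => c / (n : ℝ)) atTop (𝓝 0) :=
    tendsto_const_div_atTop_nhds_zero_nat c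
  induction m generalizing j with
  | zero =>
    have hp := ProbabilityTheory.tendsto_choose_mul_pow_of_tendsto_mul_atTop j
      (p := fun n : ℕ => c / n) (r := c) (by
        refine tendsto_const_nhds.congr' ?_
        filter_upwards [eventually_gt_atTop 0] with n hn
        field_simp)
    have h := (Complex.continuous_ofReal.tendsto _).comp ((Real.continuous_sqrt.tendsto _).comp hp)
    simp only [displacement]
    refine h.congr' ?_
    filter_upwards [eventually_cos_sin_arccos c hc, eventually_ge_atTop j] with n hn hj
    obtain ⟨h0, h1, h2, h3⟩ := hn
    obtain ⟨i, rfl⟩ := Nat.exists_eq_add_of_le' hj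
    simp only [Function.comp_apply, zero_add, Nat.add_sub_cancel]
    rw [amplitude_zero_left, h2, h3, Real.sqrt_mul (by positivity), Real.sqrt_mul (by positivity),
      sqrt_pow_eq (by positivity), sqrt_pow_eq (by linarith)]
    congr 1
    ring
  | succ m ih =>
    have hne : ((√((m : ℝ) + 1) : ℝ) : ℂ) ≠ 0 := by
      exact_mod_cast (Real.sqrt_pos.2 (by positivity)).ne'
    -- This is $\cos\theta\sqrt i$ with $i=m+1+n-j\sim n$: the small transmissivity is compensated
    -- by the large photon number.
    have l1 : Tendsto (fun n : ℕ => (√((c / n) * ((m + 1 + n - j : ℕ) : ℝ)) : ℝ)) atTop (𝓝 √c) := by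
      refine (Real.continuous_sqrt.tendsto _).comp ?_
      have : Tendsto (fun n : ℕ => c + (c / n) * ((m : ℝ) + 1 - j)) atTop (𝓝 (c + 0 * ((m : ℝ) + 1 - j))) :=
        tendsto_const_nhds.add (hdiv.mul_const _)
      rw [zero_mul, add_zero] at this
      refine this.congr' ?_
      filter_upwards [eventually_gt_atTop 0, eventually_ge_atTop j] with n hn hj
      rw [Nat.cast_sub (by omega)]
      push_cast
      field_simp
      ring
    have l2 : Tendsto (fun n : ℕ => √(1 - c / n)) atTop (𝓝 1) := by
      have := (Real.continuous_sqrt.tendsto _).comp (tendsto_const_nhds (x := (1:ℝ)).sub hdiv)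
      simpa [Function.comp_def] using this
    have l3 : Tendsto (fun n : ℕ => (√(j : ℝ) : ℂ) * amplitude (Real.arccos √(c / n)) m n
        (m + 1 + n - j, j - 1)) atTop (𝓝 (√(j : ℝ) * displacement c m (j - 1) : ℂ)) := by
      rcases j with _ | j
      · simp
      · refine (ih j).const_mul _ |>.congr fun n => ?_
        congr 2
        simp; omega
    have h := (((((Complex.continuous_ofReal.tendsto _).comp l1).mul (ih j)).sub
      (((Complex.continuous_ofReal.tendsto _).comp l2).mul l3))).div_const
        ((√((m : ℝ) + 1) : ℝ) : ℂ)
    simp only [displacement]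
    push_cast
    rw [Complex.ofReal_one, one_mul] at h
    refine h.congr' ?_
    filter_upwards [eventually_cos_sin_arccos c hc, eventually_ge_atTop j] with n hn hj
    obtain ⟨h0, h1, h2, h3⟩ := hn
    rw [div_eq_iff hne, mul_comm _ (((√((m : ℝ) + 1) : ℝ) : ℂ)), amplitude_succ, h2, h3]
    simp only [Function.comp_apply]
    rw [Real.sqrt_mul (by positivity)]
    have e : m + 1 + n - j - 1 = m + n - j := by omega
    rw [e]
    push_cast
    ring

theorem tendsto_transProb (c : ℝ) (hc : 0 < c) (m j : ℕ) :
    Tendsto (fun n : ℕ => transProb (Real.arccos √(c / n)) n m j) atTop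
      (𝓝 (displacement c m j ^ 2)) := by
  have h := (tendsto_amplitude c hc m j).norm.pow 2
  rw [Complex.norm_real, Real.norm_eq_abs, sq_abs] at h
  refine h.congr' ?_
  filter_upwards [eventually_ge_atTop j] with n hj
  rw [transProb, if_pos (by omega)]

/-! ### Generating functions of the displacement amplitudes -/

/-- The coefficient of `y ^ j` in `exp (a y) (1 - y / c) ^ m`. -/
def charlierCoeff (c a : ℂ) (m j : ℕ) : ℂ :=
  ∑ t ∈ Finset.range (j + 1), (m.choose t : ℂ) * (-1 / c) ^ t * (a ^ (j - t) / ((j - t).factorial : ℂ))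

theorem charlierCoeff_zero_left (c a : ℂ) (j : ℕ) :
    charlierCoeff c a 0 j = a ^ j / (j.factorial : ℂ) := by
  rw [charlierCoeff, Finset.sum_range_succ']
  simp

theorem charlierCoeff_zero_right (c a : ℂ) (m : ℕ) : charlierCoeff c a m 0 = 1 := by
  simp [charlierCoeff]

theorem charlierCoeff_succ_succ (c a : ℂ) (m j : ℕ) :
    charlierCoeff c a (m + 1) (j + 1) = charlierCoeff c a m (j + 1) - charlierCoeff c a m j / c := by
  rw [charlierCoeff, charlierCoeff, charlierCoeff, Finset.sum_range_succ', Finset.sum_range_succ' _ (j + 1),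
    Finset.sum_div, add_sub_right_comm, ← Finset.sum_sub_distrib]
  congr 1
  · refine Finset.sum_congr rfl fun t _ => ?_
    rw [Nat.choose_succ_succ, Nat.add_sub_add_right]
    push_cast
    ring
  · simp

/-- The displacement amplitudes are normalised Charlier polynomials: after rescaling, their
recursion in $m$ is multiplication of the generating function by $1-y/c$, which is
`charlierCoeff_succ_succ`. -/
theorem ofReal_displacement (c : ℝ) (hc : 0 < c) (m j : ℕ) :
    (displacement c m j : ℂ) = (√(j.factorial : ℝ) / √(m.factorial : ℝ) * √(Real.exp (-c))
      * √c ^ (m + j) : ℝ) * charlierCoeff c 1 m j := by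
  have hs : (√c : ℂ) * √c = c := by rw [← Complex.ofReal_mul, Real.mul_self_sqrt hc.le]
  have hc' : (c : ℂ) ≠ 0 := by exact_mod_cast hc.ne'
  have hsc : (√c : ℂ) ≠ 0 := by exact_mod_cast (Real.sqrt_pos.2 hc).ne'
  induction m generalizing j with
  | zero =>
    have hj : (√(j.factorial : ℝ) : ℂ) * √(j.factorial : ℝ) = j.factorial := by
      rw [← Complex.ofReal_mul, Real.mul_self_sqrt (by positivity)]; simp
    have hj' : (√(j.factorial : ℝ) : ℂ) ≠ 0 := by
      exact_mod_cast (Real.sqrt_pos.2 (by positivity)).ne'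
    rw [displacement, charlierCoeff_zero_left, Real.sqrt_div (by positivity),
      Real.sqrt_mul (by positivity), sqrt_pow_eq hc.le, ← hj]
    push_cast
    simp
    field_simp
  | succ m ih =>
    have hm : (√((m : ℝ) + 1) : ℂ) ≠ 0 := by
      exact_mod_cast (Real.sqrt_pos.2 (by positivity)).ne'
    have hm' : (√(m.factorial : ℝ) : ℂ) ≠ 0 := by
      exact_mod_cast (Real.sqrt_pos.2 (by positivity)).ne'
    have hf : √((m + 1).factorial : ℝ) = √((m : ℝ) + 1) * √(m.factorial : ℝ) := by
      rw [← Real.sqrt_mul (by positivity), Nat.factorial_succ]; push_cast; rfl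
    rw [displacement]
    push_cast
    rw [ih, ih, hf]
    rcases j with _ | j
    · simp only [charlierCoeff_zero_right]
      push_cast
      simp
      field_simp
      ring
    · have hf : √((j + 1).factorial : ℝ) = √((j : ℝ) + 1) * √(j.factorial : ℝ) := by
        rw [← Real.sqrt_mul (by positivity), Nat.factorial_succ]; push_cast; rfl
      have hj : (√((j : ℝ) + 1) : ℂ) * √((j : ℝ) + 1) = j + 1 := ofReal_sqrt_succ_mul_self j
      rw [charlierCoeff_succ_succ, hf, Nat.add_sub_cancel, ← hs]
      push_cast
      field_simp
      ring

/-- Since $\binom mr/m!=1/(r!\,(m-r)!)$, the binomial weight amounts to the shift $m=k+r$; the terms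
with $m<r$ vanish. -/
theorem hasSum_exp_mul_choose (z : ℂ) (r : ℕ) (f : ℕ → ℂ) (s : ℂ)
    (h : HasSum (fun k : ℕ => z ^ k / (k.factorial : ℂ) * f (k + r)) s) :
    HasSum (fun m : ℕ => z ^ m / (m.factorial : ℂ) * ((m.choose r : ℂ) * f m))
      (z ^ r / (r.factorial : ℂ) * s) := by
  rw [← hasSum_nat_add_iff' r, Finset.sum_eq_zero, sub_zero]
  · convert! h.mul_left (z ^ r / (r.factorial : ℂ)) using 1
    ext k
    have h1 : ((k + r).factorial : ℂ) = (k + r).choose r * r.factorial * k.factorial := by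
      have := Nat.choose_mul_factorial_mul_factorial (Nat.le_add_left r k)
      rw [Nat.add_sub_cancel] at this
      exact_mod_cast this.symm
    have h2 : (((k + r).choose r : ℕ) : ℂ) ≠ 0 := by
      exact_mod_cast (Nat.choose_pos (Nat.le_add_left r k)).ne'
    have h3 : (r.factorial : ℂ) ≠ 0 := by exact_mod_cast r.factorial_ne_zero
    have h4 : (k.factorial : ℂ) ≠ 0 := by exact_mod_cast k.factorial_ne_zero
    rw [h1]
    field_simp
    ring
  · intro i hi
    rw [Nat.choose_eq_zero_of_lt (Finset.mem_range.1 hi)]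
    simp

theorem hasSum_cexp (z : ℂ) : HasSum (fun k : ℕ => z ^ k / (k.factorial : ℂ)) (Complex.exp z) := by
  rw [Complex.exp_eq_exp_ℂ]
  exact NormedSpace.expSeries_div_hasSum_exp z

theorem sum_range_binomial (b y : ℂ) (j : ℕ) :
    ∑ t ∈ Finset.range (j + 1), y ^ t / (t.factorial : ℂ) * (b ^ (j - t) / ((j - t).factorial : ℂ))
      = (y + b) ^ j / (j.factorial : ℂ) := by
  rw [add_pow, Finset.sum_div]
  refine Finset.sum_congr rfl fun t ht => ?_
  rw [Nat.cast_choose ℂ (Finset.mem_range_succ_iff.1 ht)]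
  have h3 : (t.factorial : ℂ) ≠ 0 := by exact_mod_cast t.factorial_ne_zero
  have h4 : ((j - t).factorial : ℂ) ≠ 0 := by exact_mod_cast (j - t).factorial_ne_zero
  have h5 : (j.factorial : ℂ) ≠ 0 := by exact_mod_cast j.factorial_ne_zero
  field_simp

/-- Compare coefficients of $y^j$ in
$\sum_k\frac{(xc)^k}{k!}e^y(1-y/c)^{k+r}=e^{xc}e^{(1-x)y}(1-y/c)^r$. The induction on $r$ applies
the recursion on both sides. -/
theorem hasSum_charlierCoeff_add (c x : ℂ) (hc : c ≠ 0) (r j : ℕ) :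
    HasSum (fun k : ℕ => (x * c) ^ k / (k.factorial : ℂ) * charlierCoeff c 1 (k + r) j)
      (Complex.exp (x * c) * charlierCoeff c (1 - x) r j) := by
  induction r generalizing j with
  | zero =>
    have h : HasSum (fun k : ℕ => ∑ t ∈ Finset.range (j + 1), (-1 / c) ^ t
        * (1 / ((j - t).factorial : ℂ)) * ((x * c) ^ k / (k.factorial : ℂ) * ((k.choose t : ℂ) * 1)))
        (∑ t ∈ Finset.range (j + 1), (-1 / c) ^ t
        * (1 / ((j - t).factorial : ℂ)) * ((x * c) ^ t / (t.factorial : ℂ) * Complex.exp (x * c))) :=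
      hasSum_sum fun t _ => (hasSum_exp_mul_choose (x * c) t (fun _ => 1) _
        (by simpa using hasSum_cexp (x * c))).mul_left _
    have e : ∑ t ∈ Finset.range (j + 1), (-1 / c) ^ t * (1 / ((j - t).factorial : ℂ))
          * ((x * c) ^ t / (t.factorial : ℂ) * Complex.exp (x * c))
        = Complex.exp (x * c) * charlierCoeff c (1 - x) 0 j := by
      rw [charlierCoeff_zero_left, sub_eq_neg_add, ← sum_range_binomial, Finset.mul_sum]
      refine Finset.sum_congr rfl fun t _ => ?_
      rw [one_pow, mul_pow, div_pow, neg_pow x]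
      field_simp
    rw [e] at h
    convert! h using 1
    ext k
    rw [add_zero, charlierCoeff, Finset.mul_sum]
    refine Finset.sum_congr rfl fun t _ => ?_
    rw [one_pow]; ring
  | succ r ih =>
    rcases j with _ | j
    · simpa [charlierCoeff_zero_right] using ih 0
    · have h := (ih (j + 1)).sub ((ih j).div_const c)
      convert! h using 1
      · ext k
        rw [← add_assoc, charlierCoeff_succ_succ]; ring
      · rw [charlierCoeff_succ_succ]; ring

theorem sum_range_choose (x : ℂ) (i j : ℕ) (hij : i ≤ j) :
    ∑ r ∈ Finset.range (j + 1), (-x) ^ r / (r.factorial : ℂ) * (1 / ((j - r).factorial : ℂ))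
        * (r.choose i : ℂ)
      = (-x) ^ i / (i.factorial : ℂ) * ((1 - x) ^ (j - i) / ((j - i).factorial : ℂ)) := by
  obtain ⟨d, rfl⟩ := Nat.exists_eq_add_of_le hij
  rw [add_assoc, Finset.sum_range_add, Finset.sum_eq_zero, zero_add, Nat.add_sub_cancel_left,
    sub_eq_neg_add, ← sum_range_binomial, Finset.mul_sum]
  · refine Finset.sum_congr rfl fun t ht => ?_
    have ht' := Finset.mem_range_succ_iff.1 ht
    rw [Nat.add_sub_add_left, Nat.cast_choose ℂ (Nat.le_add_right i t), Nat.add_sub_cancel_left,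
      one_pow, pow_add]
    have h1 : (t.factorial : ℂ) ≠ 0 := by exact_mod_cast t.factorial_ne_zero
    have h2 : (i.factorial : ℂ) ≠ 0 := by exact_mod_cast i.factorial_ne_zero
    have h3 : ((i + t).factorial : ℂ) ≠ 0 := by exact_mod_cast (i + t).factorial_ne_zero
    field_simp
  · intro t ht
    rw [Nat.choose_eq_zero_of_lt (Finset.mem_range.1 ht)]
    simp

/-- A bilinear generating function of Charlier polynomials. One factor is expanded in $\binom mr$,
which turns the sum over $m$ into `hasSum_charlierCoeff_add`; the remaining double sum collapses by
`sum_range_choose`. Complex $x$ is needed, since $x=\frac N{N+1}s$ with $|s|=1$ will give the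
characteristic function of $m-e$. -/
theorem hasSum_pow_mul_displacement_sq (c : ℝ) (hc : 0 < c) (x : ℂ) (j : ℕ) :
    HasSum (fun m : ℕ => x ^ m * ((displacement c m j ^ 2 : ℝ) : ℂ))
      (Complex.exp (-c * (1 - x)) * ∑ u ∈ Finset.range (j + 1),
        (j.choose u : ℂ) * x ^ (j - u) * (((1 - x) ^ 2 * c) ^ u / (u.factorial : ℂ))) := by
  have hc' : (c : ℂ) ≠ 0 := by exact_mod_cast hc.ne'
  have h : HasSum (fun m : ℕ => ∑ r ∈ Finset.range (j + 1), (-1 / (c : ℂ)) ^ r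
        * (1 / ((j - r).factorial : ℂ)) * ((x * c) ^ m / (m.factorial : ℂ)
          * ((m.choose r : ℂ) * charlierCoeff c 1 m j)))
        (∑ r ∈ Finset.range (j + 1), (-1 / (c : ℂ)) ^ r * (1 / ((j - r).factorial : ℂ))
          * ((x * c) ^ r / (r.factorial : ℂ)
            * (Complex.exp (x * c) * charlierCoeff c (1 - x) r j))) :=
    hasSum_sum fun r _ => (hasSum_exp_mul_choose (x * c) r (fun m => charlierCoeff c 1 m j) _
        (hasSum_charlierCoeff_add c x hc' r j)).mul_left _
  have h2 := h.mul_left ((j.factorial : ℂ) * Complex.exp (-c) * c ^ j)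
  convert! h2 using 1
  · ext m
    have hsq : ((√(j.factorial : ℝ) / √(m.factorial : ℝ) * √(Real.exp (-c)) * √c ^ (m + j) : ℝ)) ^ 2
        = j.factorial / m.factorial * Real.exp (-c) * c ^ (m + j) := by
      rw [mul_pow, mul_pow, div_pow, Real.sq_sqrt (by positivity), Real.sq_sqrt (by positivity),
        Real.sq_sqrt (by positivity), ← pow_mul, mul_comm _ 2, pow_mul, Real.sq_sqrt hc.le]
    have e : ∑ r ∈ Finset.range (j + 1), (-1 / (c : ℂ)) ^ r
        * (1 / ((j - r).factorial : ℂ)) * ((x * c) ^ m / (m.factorial : ℂ)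
          * ((m.choose r : ℂ) * charlierCoeff c 1 m j))
        = (x * c) ^ m / (m.factorial : ℂ) * charlierCoeff c 1 m j ^ 2 := by
      rw [sq]
      nth_rw 2 [charlierCoeff]
      rw [Finset.sum_mul, Finset.mul_sum]
      refine Finset.sum_congr rfl fun t _ => ?_
      rw [one_pow]; ring
    rw [e, Complex.ofReal_pow, ofReal_displacement c hc, mul_pow, ← Complex.ofReal_pow, hsq]
    push_cast
    rw [mul_pow, pow_add]
    ring
  · have e : ∀ r ∈ Finset.range (j + 1), (-1 / (c : ℂ)) ^ r * (1 / ((j - r).factorial : ℂ))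
          * ((x * c) ^ r / (r.factorial : ℂ)
            * (Complex.exp (x * c) * charlierCoeff c (1 - x) r j))
        = ∑ i ∈ Finset.range (j + 1), Complex.exp (x * c) * ((-1 / c) ^ i
          * ((1 - x) ^ (j - i) / ((j - i).factorial : ℂ))) *
          ((-x) ^ r / (r.factorial : ℂ) * (1 / ((j - r).factorial : ℂ)) * (r.choose i : ℂ)) := by
      intro r _
      rw [charlierCoeff, Finset.mul_sum, Finset.mul_sum, Finset.mul_sum]
      refine Finset.sum_congr rfl fun i _ => ?_
      have : (-1 / (c : ℂ)) ^ r * (x * c) ^ r = (-x) ^ r := by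
        rw [← mul_pow]; congr 1; field_simp
      rw [← this]
      ring
    have e' : ∑ i ∈ Finset.range (j + 1), ∑ r ∈ Finset.range (j + 1), Complex.exp (x * c)
          * ((-1 / c) ^ i * ((1 - x) ^ (j - i) / ((j - i).factorial : ℂ))) *
          ((-x) ^ r / (r.factorial : ℂ) * (1 / ((j - r).factorial : ℂ)) * (r.choose i : ℂ))
        = ∑ i ∈ Finset.range (j + 1), Complex.exp (x * c)
          * ((-1 / c) ^ i * ((1 - x) ^ (j - i) / ((j - i).factorial : ℂ))) *
          ((-x) ^ i / (i.factorial : ℂ) * ((1 - x) ^ (j - i) / ((j - i).factorial : ℂ))) := by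
      refine Finset.sum_congr rfl fun i hi => ?_
      rw [← Finset.mul_sum, sum_range_choose x i j (Finset.mem_range_succ_iff.1 hi)]
    rw [Finset.sum_congr rfl e, Finset.sum_comm, e', Finset.mul_sum, Finset.mul_sum,
      ← Finset.sum_range_reflect (fun u => Complex.exp (-c * (1 - x)) * ((j.choose u : ℂ)
        * x ^ (j - u) * (((1 - x) ^ 2 * c) ^ u / (u.factorial : ℂ))))]
    refine Finset.sum_congr rfl fun i hi => ?_
    have hi' := Finset.mem_range_succ_iff.1 hi
    have e1 : j + 1 - 1 - i = j - i := by omega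
    have e2 : j - (j - i) = i := by omega
    have hexp : Complex.exp (-c * (1 - x)) = Complex.exp (-c) * Complex.exp (x * c) := by
      rw [← Complex.exp_add]; congr 1; ring
    rw [e1, Nat.choose_symm hi', e2, Nat.cast_choose ℂ hi', hexp]
    have h1 : (i.factorial : ℂ) ≠ 0 := by exact_mod_cast i.factorial_ne_zero
    have h2 : ((j - i).factorial : ℂ) ≠ 0 := by exact_mod_cast (j - i).factorial_ne_zero
    have h3 : (c : ℂ) ^ j = c ^ i * c ^ (j - i) := by rw [← pow_add]; congr 1; omega
    have h4 : x ^ i = (-1 / (c : ℂ)) ^ i * (-x) ^ i * c ^ i := by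
      rw [← mul_pow, ← mul_pow]; congr 1; field_simp
    rw [h3, h4, mul_pow, ← pow_mul, two_mul, pow_add]
    field_simp

/-- Essentially the Laguerre generating function. With $u$ fixed, the sum over $j-u$ is the negative
binomial series; the sum over $u$ is then exponential. Absolute convergence allows regrouping along
$j=u+k$. -/
theorem hasSum_choose_exp (x : ℝ) (hx0 : 0 ≤ x) (hx1 : x < 1) (B : ℂ) :
    HasSum (fun j : ℕ => ∑ u ∈ Finset.range (j + 1),
        (j.choose u : ℂ) * x ^ (j - u) * (B ^ u / (u.factorial : ℂ)))
      (Complex.exp (B / (1 - x)) / (1 - x)) := by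
  have hx : ‖(x : ℂ)‖ < 1 := by rwa [Complex.norm_real, Real.norm_eq_abs, abs_of_nonneg hx0]
  have h1x : (1 - (x : ℂ)) ≠ 0 := by
    rw [← Complex.ofReal_one, ← Complex.ofReal_sub]; exact_mod_cast (sub_pos.2 hx1).ne'
  have hrow : ∀ (y : ℝ) (u : ℕ), HasSum (fun k : ℕ => ((u + k).choose u : ℝ) * x ^ k
      * (y ^ u / (u.factorial : ℝ))) ((y / (1 - x)) ^ u / (u.factorial : ℝ) / (1 - x)) := by
    intro y u
    have := (hasSum_choose_mul_geometric_of_norm_lt_one u (r := x)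
      (by rwa [Real.norm_eq_abs, abs_of_nonneg hx0])).mul_right (y ^ u / (u.factorial : ℝ))
    convert! this using 1
    · ext k; rw [add_comm u k]
    · have : (1 - x) ≠ 0 := (sub_pos.2 hx1).ne'
      rw [pow_succ, div_pow]; field_simp
  have hrowC : ∀ u : ℕ, HasSum (fun k : ℕ => ((u + k).choose u : ℂ) * x ^ k
      * (B ^ u / (u.factorial : ℂ))) ((B / (1 - x)) ^ u / (u.factorial : ℂ) / (1 - x)) := by
    intro u
    have := (hasSum_choose_mul_geometric_of_norm_lt_one u (r := (x : ℂ)) hx).mul_right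
      (B ^ u / (u.factorial : ℂ))
    convert! this using 1
    · ext k; rw [add_comm u k]
    · rw [pow_succ, div_pow]; field_simp
  have hsum : Summable (fun p : ℕ × ℕ => ((p.1 + p.2).choose p.1 : ℂ) * x ^ p.2
      * (B ^ p.1 / (p.1.factorial : ℂ))) := by
    refine Summable.of_norm ?_
    have e : (fun p : ℕ × ℕ => ‖((p.1 + p.2).choose p.1 : ℂ) * x ^ p.2
      * (B ^ p.1 / (p.1.factorial : ℂ))‖) = fun p : ℕ × ℕ => ((p.1 + p.2).choose p.1 : ℝ) * x ^ p.2
      * (‖B‖ ^ p.1 / (p.1.factorial : ℝ)) := by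
      ext p
      simp [abs_of_nonneg hx0]
    rw [e, summable_prod_of_nonneg (fun p => by positivity)]
    refine ⟨fun u => (hrow _ u).summable, ?_⟩
    simp_rw [fun u => (hrow ‖B‖ u).tsum_eq]
    exact (Real.summable_pow_div_factorial _).div_const _
  have htot := (hasSum_cexp (B / (1 - x))).div_const (1 - (x : ℂ))
  have h1 : HasSum (fun p : ℕ × ℕ => ((p.1 + p.2).choose p.1 : ℂ) * x ^ p.2
      * (B ^ p.1 / (p.1.factorial : ℂ))) (Complex.exp (B / (1 - x)) / (1 - x)) := by
    have h2 := hsum.hasSum.prod_fiberwise hrowC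
    rw [← h2.unique htot]
    exact hsum.hasSum
  have h2 := ((Finset.HasAntidiagonal.sigmaAntidiagonalEquivProd (A := ℕ)).hasSum_iff.2 h1).sigma (fun j => hasSum_fintype _)
  convert! h2 using 1
  ext j
  rw [Finset.univ_eq_attach]
  simp only [Function.comp_apply, Finset.HasAntidiagonal.sigmaAntidiagonalEquivProd_apply]
  rw [Finset.sum_attach (Finset.HasAntidiagonal.antidiagonal j) (fun p => ((p.1 + p.2).choose p.1 : ℂ) * x ^ p.2
      * (B ^ p.1 / (p.1.factorial : ℂ))), Finset.Nat.sum_antidiagonal_eq_sum_range_succ_mk]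
  refine Finset.sum_congr rfl fun u hu => ?_
  simp only
  rw [Nat.add_sub_cancel' (Finset.mem_range_succ_iff.1 hu)]

/-! ### The limit distributions as marginals -/

/-- The law of `m - e` under the weights `J (m, e)`. -/
def diffMarginal (J : ℕ × ℕ → ℝ) (k : ℤ) : ℝ :=
  ∑' m : ℕ, if k ≤ m then J (m, ((m : ℤ) - k).toNat) else 0

theorem summable_diff_extend {J : ℕ × ℕ → ℝ} (hJ : Summable J) :
    Summable fun x : ℤ × ℕ => if x.1 ≤ x.2 then J (x.2, ((x.2 : ℤ) - x.1).toNat) else 0 := by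
  have hinj : Function.Injective fun p : ℕ × ℕ => (((p.1 : ℤ) - p.2, p.1) : ℤ × ℕ) := by
    rintro ⟨a, b⟩ ⟨a', b'⟩ h
    simp only [Prod.mk.injEq] at h ⊢
    omega
  rw [← hinj.summable_iff]
  · convert! hJ using 1
    ext ⟨a, b⟩
    simp
  · rintro ⟨k, m⟩ h
    rw [if_neg]
    intro hkm
    refine h ⟨(m, ((m : ℤ) - k).toNat), ?_⟩
    simp only at hkm
    simp only [Prod.mk.injEq, and_true]
    omega

/-- The characteristic function of $m-e$. The injection $(m,e)\mapsto(m-e,m)$ moves the weights to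
$\mathbb Z\times\mathbb N$ (zero off its range), where the series is summed fibrewise over the
difference. -/
theorem hasSum_diffMarginal {J : ℕ × ℕ → ℝ} (hJ : Summable J) {s : ℂ} (hs : ‖s‖ = 1) :
    HasSum (fun k : ℤ => (diffMarginal J k : ℂ) * s ^ k)
      (∑' p : ℕ × ℕ, (J p : ℂ) * s ^ ((p.1 : ℤ) - p.2)) := by
  have hinj : Function.Injective fun p : ℕ × ℕ => (((p.1 : ℤ) - p.2, p.1) : ℤ × ℕ) := by
    rintro ⟨a, b⟩ ⟨a', b'⟩ h
    simp only [Prod.mk.injEq] at h ⊢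
    omega
  have hsumm : Summable fun p : ℕ × ℕ => (J p : ℂ) * s ^ ((p.1 : ℤ) - p.2) := by
    refine Summable.of_norm ?_
    simpa [hs] using hJ.norm
  set g : ℤ × ℕ → ℂ := fun x =>
    ((if x.1 ≤ x.2 then J (x.2, ((x.2 : ℤ) - x.1).toNat) else 0 : ℝ) : ℂ) * s ^ x.1 with hg
  have h : HasSum g (∑' p : ℕ × ℕ, (J p : ℂ) * s ^ ((p.1 : ℤ) - p.2)) := by
    rw [← hinj.hasSum_iff]
    · convert! hsumm.hasSum using 1
      ext ⟨a, b⟩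
      simp [hg]
    · rintro ⟨k, m⟩ h
      simp only [hg]
      rw [if_neg, Complex.ofReal_zero, zero_mul]
      intro hkm
      refine h ⟨(m, ((m : ℤ) - k).toNat), ?_⟩
      simp only [Prod.mk.injEq, and_true]
      omega
  refine h.prod_fiberwise fun k => ?_
  have := ((summable_diff_extend hJ).prod_factor k).hasSum
  exact (Complex.hasSum_ofReal.2 this).mul_right (s ^ k)

theorem diffMarginal_nonneg {J : ℕ × ℕ → ℝ} (hJ : ∀ p, 0 ≤ J p) (k : ℤ) : 0 ≤ diffMarginal J k :=
  tsum_nonneg fun m => by split_ifs <;> simp [hJ]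

/-- An absolutely convergent Fourier series which vanishes identically has zero coefficients. -/
theorem eq_zero_of_hasSum_circle {a : ℤ → ℂ} (ha : Summable fun k => ‖a k‖)
    (h : ∀ s : ℂ, ‖s‖ = 1 → HasSum (fun k : ℤ => a k * s ^ k) 0) : a = 0 := by
  have : Fact (0 < (1 : ℝ)) := ⟨one_pos⟩
  have hsum : Summable fun k : ℤ => a k • (fourier k : C(AddCircle (1 : ℝ), ℂ)) := by
    refine Summable.of_norm ?_
    simpa [norm_smul, fourier_norm] using ha
  have hF : (∑' k : ℤ, a k • (fourier k : C(AddCircle (1 : ℝ), ℂ))) = 0 := by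
    ext x
    have h1 := (ContinuousMap.evalCLM ℂ x).hasSum hsum.hasSum
    have h2 := h (AddCircle.toCircle x) (Circle.norm_coe _)
    refine h1.unique ?_
    convert! h2 using 1
    ext k
    simp [fourier_apply, AddCircle.toCircle_zsmul]
  have h0 := hsum.hasSum
  rw [hF] at h0
  ext n
  have hL := ((innerSL ℂ (fourierLp (T := (1:ℝ)) 2 n)) ∘L
    (ContinuousMap.toLp (E := ℂ) 2 AddCircle.haarAddCircle ℂ)).hasSum h0
  have key : ∀ k : ℤ, ((innerSL ℂ (fourierLp (T := (1:ℝ)) 2 n)) ∘L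
    (ContinuousMap.toLp (E := ℂ) 2 AddCircle.haarAddCircle ℂ)) (a k • fourier k)
      = if k = n then a n else 0 := by
    intro k
    have := (orthonormal_iff_ite.1 (orthonormal_fourier (T := (1 : ℝ)))) n k
    rw [map_smul]
    have h' : ((innerSL ℂ (fourierLp (T := (1:ℝ)) 2 n)) ∘L
      (ContinuousMap.toLp (E := ℂ) 2 AddCircle.haarAddCircle ℂ)) (fourier k)
        = inner ℂ (fourierLp (T := (1:ℝ)) 2 n) (fourierLp 2 k) := rfl
    rw [h', this]
    by_cases hk : n = k
    · subst hk; simp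
    · simp [hk, Ne.symm hk]
  simp only [key, map_zero] at hL
  exact ((hasSum_ite_eq n (a n)).unique hL)

/-- Fourier uniqueness: equal characteristic functions on the unit circle give equal laws of the
difference. -/
theorem diffMarginal_eq {J J' : ℕ × ℕ → ℝ} (hJ : Summable J) (hJ' : Summable J')

    (h : ∀ s : ℂ, ‖s‖ = 1 → ∑' p : ℕ × ℕ, (J p : ℂ) * s ^ ((p.1 : ℤ) - p.2)
      = ∑' p : ℕ × ℕ, (J' p : ℂ) * s ^ ((p.1 : ℤ) - p.2)) (k : ℤ) :
    diffMarginal J k = diffMarginal J' k := by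
  have hs : ∀ {J : ℕ × ℕ → ℝ}, Summable J → Summable (diffMarginal J) := by
    intro J hJ
    have := (hasSum_diffMarginal hJ (s := 1) (by simp)).summable
    simpa [Complex.summable_ofReal] using this
  have key := eq_zero_of_hasSum_circle (a := fun k => (diffMarginal J k : ℂ) - diffMarginal J' k)
    (by
      have := ((hs hJ).sub (hs hJ')).norm
      convert! this using 1
      ext k
      rw [← Complex.ofReal_sub, Complex.norm_real]) (by
      intro s hs
      have := (hasSum_diffMarginal hJ hs).sub (hasSum_diffMarginal hJ' hs)
      rw [h s hs, sub_self] at this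
      simpa [sub_mul] using this)
  have := congrFun key k
  simp only [Pi.zero_apply, sub_eq_zero] at this
  exact_mod_cast this

/-! ### Thermal weights, and $p$ and $q$ as laws derived from `jointDist`. -/

/-- The weight of `m` photons in the thermal state. -/
def thermalWeight (N : ℝ) (m : ℕ) : ℝ := 1 / (N + 1) * (N / (N + 1)) ^ m

theorem thermalWeight_nonneg {N : ℝ} (hN : 0 < N) (m : ℕ) : 0 ≤ thermalWeight N m := by
  unfold thermalWeight; positivity

theorem ratio_lt_one {N : ℝ} (hN : 0 < N) : N / (N + 1) < 1 := by
  rw [div_lt_one (by positivity)]; linarith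

theorem one_sub_ratio {N : ℝ} (hN : 0 < N) : 1 - N / (N + 1) = 1 / (N + 1) := by
  field_simp; ring

theorem hasSum_thermalWeight {N : ℝ} (hN : 0 < N) : HasSum (thermalWeight N) 1 := by
  have := (hasSum_geometric_of_lt_one (by positivity) (ratio_lt_one hN)).mul_left (1 / (N + 1))
  rw [one_sub_ratio hN] at this
  convert! this using 1
  field_simp

theorem hasSum_mul_thermalWeight {N : ℝ} (hN : 0 < N) :
    HasSum (fun m : ℕ => (m : ℝ) * thermalWeight N m) N := by
  have := (hasSum_coe_mul_geometric_of_norm_lt_one (r := N / (N + 1)) (by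
    rw [Real.norm_eq_abs, abs_of_nonneg (by positivity)]; exact ratio_lt_one hN)).mul_left (1 / (N + 1))
  rw [one_sub_ratio hN] at this
  convert! this using 1
  · ext m; simp only [thermalWeight]; ring
  · field_simp

/-- Joint distribution of the numbers of photons before and after the displacement. -/
def jointDist (N c : ℝ) (p : ℕ × ℕ) : ℝ := thermalWeight N p.1 * displacement c p.1 p.2 ^ 2

theorem jointDist_nonneg {N : ℝ} (c : ℝ) (hN : 0 < N) (p : ℕ × ℕ) : 0 ≤ jointDist N c p :=
  mul_nonneg (thermalWeight_nonneg hN _) (sq_nonneg _)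

theorem pDist_natCast (N c : ℝ) (hN : 0 < N) (j : ℕ) : (pDist N c j : ℂ)
    = (1 / (N + 1)) * (Complex.exp (-c * (1 - (N / (N + 1) : ℝ))) * ∑ u ∈ Finset.range (j + 1),
        (j.choose u : ℂ) * (N / (N + 1) : ℝ) ^ (j - u)
          * (((1 - (N / (N + 1) : ℝ)) ^ 2 * c) ^ u / (u.factorial : ℂ))) := by
  have h1 : (N : ℂ) + 1 ≠ 0 := by exact_mod_cast (show N + 1 ≠ 0 by positivity)
  have h2 : (N : ℂ) ≠ 0 := by exact_mod_cast hN.ne'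
  have h3 : (1 : ℂ) - ((N / (N + 1) : ℝ) : ℂ) = 1 / (N + 1) := by
    rw [← Complex.ofReal_one, ← Complex.ofReal_sub, one_sub_ratio hN]; push_cast; rfl
  rw [h3]
  simp only [pDist, Nat.cast_nonneg, if_true, Int.toNat_natCast, laguerreL]
  push_cast
  have h4 : -(c : ℂ) / (N + 1) = -c * (1 / (N + 1)) := by ring
  rw [h4, Finset.mul_sum, Finset.mul_sum, Finset.mul_sum]
  refine Finset.sum_congr rfl fun u hu => ?_
  obtain ⟨d, rfl⟩ := Nat.exists_eq_add_of_le (Finset.mem_range_succ_iff.1 hu)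
  have h5 : ((-1 : ℂ)) ^ u * (-c / (N * (N + 1))) ^ u = (c / (N * (N + 1))) ^ u := by
    rw [← mul_pow]; congr 1; ring
  rw [Nat.add_sub_cancel_left]
  have h6 : ((N : ℂ)) ^ (u + d) / (N + 1) ^ (u + d + 1) * (c / (N * (N + 1))) ^ u
      = 1 / (N + 1) * ((N / (N + 1)) ^ d * ((1 / (N + 1)) ^ 2 * c) ^ u) := by
    simp only [div_pow, mul_pow, pow_add]
    field_simp
    rw [one_pow, ← pow_mul, ← pow_mul]
    ring
  linear_combination (N : ℂ) ^ (u + d) / (N + 1) ^ (u + d + 1) * Complex.exp (-c * (1 / (N + 1)))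
      * ((u + d).choose u / u.factorial) * h5
    + Complex.exp (-c * (1 / (N + 1))) * ((u + d).choose u / u.factorial) * h6

/-- The bilinear generating function at $x=N/(N+1)$; its finite sum is the Laguerre polynomial in
`pDist`. This also yields $p_k\ge0$. -/
theorem hasSum_jointDist_left (N c : ℝ) (hN : 0 < N) (hc : 0 < c) (j : ℕ) :
    HasSum (fun m => jointDist N c (m, j)) (pDist N c j) := by
  rw [← Complex.hasSum_ofReal, pDist_natCast N c hN]
  convert! (hasSum_pow_mul_displacement_sq c hc (N / (N + 1) : ℝ) j).mul_left (1 / ((N : ℂ) + 1)) using 1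
  ext m
  simp only [jointDist, thermalWeight]
  push_cast
  ring

theorem pDist_nonneg (N c : ℝ) (hN : 0 < N) (hc : 0 < c) (k : ℤ) : 0 ≤ pDist N c k := by
  rcases lt_or_ge k 0 with hk | hk
  · rw [pDist, if_neg (by omega)]
  · obtain ⟨j, rfl⟩ := Int.eq_ofNat_of_zero_le hk
    exact (hasSum_jointDist_left N c hN hc j).nonneg fun m => jointDist_nonneg c hN _

theorem hasSum_pDist_nat (N c : ℝ) (hN : 0 < N) : HasSum (fun j : ℕ => pDist N c j) 1 := by
  rw [← Complex.hasSum_ofReal]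
  have h := (hasSum_choose_exp (N / (N + 1)) (by positivity) (ratio_lt_one hN)
    ((1 - (N / (N + 1) : ℝ)) ^ 2 * c)).mul_left (1 / ((N : ℂ) + 1)
      * Complex.exp (-c * (1 - (N / (N + 1) : ℝ))))
  have h1 : (N : ℂ) + 1 ≠ 0 := by exact_mod_cast (show N + 1 ≠ 0 by positivity)
  have h3 : (1 : ℂ) - ((N / (N + 1) : ℝ) : ℂ) = 1 / (N + 1) := by
    rw [← Complex.ofReal_one, ← Complex.ofReal_sub, one_sub_ratio hN]; push_cast; rfl
  convert! h using 1
  · ext j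
    rw [pDist_natCast N c hN, mul_assoc]
  · rw [h3, mul_assoc, ← mul_div_assoc, ← Complex.exp_add]
    have : -(c : ℂ) * (1 / (N + 1)) + (1 / (N + 1)) ^ 2 * c / (1 / (N + 1)) = 0 := by
      field_simp; ring
    rw [this, Complex.exp_zero]
    field_simp
    simp

theorem hasSum_pDist (N c : ℝ) (hN : 0 < N) : HasSum (pDist N c) 1 := by
  have h := hasSum_pDist_nat N c hN
  rw [← Nat.cast_injective.hasSum_iff (g := ((↑) : ℕ → ℤ))]
  · exact h
  · intro k hk
    rw [pDist, if_neg]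
    intro h0
    exact hk ⟨k.toNat, Int.toNat_of_nonneg h0⟩

theorem summable_jointDist (N c : ℝ) (hN : 0 < N) (hc : 0 < c) : Summable (jointDist N c) := by
  have h : Summable fun p : ℕ × ℕ => jointDist N c (p.2, p.1) := by
    rw [summable_prod_of_nonneg (fun p => jointDist_nonneg c hN _)]
    refine ⟨fun j => (hasSum_jointDist_left N c hN hc j).summable, ?_⟩
    convert! (hasSum_pDist_nat N c hN).summable using 1
    ext j
    exact (hasSum_jointDist_left N c hN hc j).tsum_eq
  exact (Equiv.prodComm ℕ ℕ).summable_iff.1 h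

/-- Write $x=N/(N+1)$. For fixed $e=j$ the sum over $m$ is the bilinear generating function at $xs$.
Absorbing $s^{-j}$ leaves powers of the real $x$ and $B=(1-xs)^2c/s$, so `hasSum_choose_exp`
performs the sum over $j$. The exponent $-c(1-xs)+(N+1)B$ then simplifies to that of a difference of
two Poisson variables. -/
theorem tsum_jointDist_mul_zpow (N c : ℝ) (hN : 0 < N) (hc : 0 < c) (s : ℂ) (hs : ‖s‖ = 1) :
    ∑' p : ℕ × ℕ, (jointDist N c p : ℂ) * s ^ ((p.1 : ℤ) - p.2)
      = Complex.exp (c * (N + 1) * (s⁻¹ - 1) + c * N * (s - 1)) := by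
  have hs0 : s ≠ 0 := by rintro rfl; simp at hs
  have hsumm : Summable fun p : ℕ × ℕ => (jointDist N c p : ℂ) * s ^ ((p.1 : ℤ) - p.2) := by
    refine Summable.of_norm ?_
    simpa [hs] using (summable_jointDist N c hN hc).norm
  set x : ℂ := ((N / (N + 1) : ℝ) : ℂ) with hx
  have hcol : ∀ j : ℕ, HasSum (fun m : ℕ => (jointDist N c (m, j) : ℂ) * s ^ ((m : ℤ) - j))
      (1 / (N + 1) * Complex.exp (-c * (1 - x * s)) * ∑ u ∈ Finset.range (j + 1),
        (j.choose u : ℂ) * x ^ (j - u) * (((1 - x * s) ^ 2 * c / s) ^ u / (u.factorial : ℂ))) := by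
    intro j
    have h := (hasSum_pow_mul_displacement_sq c hc (x * s) j).mul_left (1 / ((N : ℂ) + 1) * (s ^ j)⁻¹)
    convert! h using 1
    · ext m
      rw [zpow_sub₀ hs0, zpow_natCast, zpow_natCast, jointDist, thermalWeight, hx]
      push_cast
      ring
    · rw [Finset.mul_sum, Finset.mul_sum, Finset.mul_sum]
      refine Finset.sum_congr rfl fun u hu => ?_
      obtain ⟨d, rfl⟩ := Nat.exists_eq_add_of_le (Finset.mem_range_succ_iff.1 hu)
      rw [Nat.add_sub_cancel_left, div_pow, mul_pow x s d, pow_add]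
      field_simp
  have h1 := ((Equiv.prodComm ℕ ℕ).hasSum_iff.2 hsumm.hasSum).prod_fiberwise hcol
  have h2 := (hasSum_choose_exp (N / (N + 1)) (by positivity) (ratio_lt_one hN)
    ((1 - x * s) ^ 2 * c / s)).mul_left (1 / ((N : ℂ) + 1) * Complex.exp (-c * (1 - x * s)))
  rw [h1.unique h2]
  have h1 : (N : ℂ) + 1 ≠ 0 := by exact_mod_cast (show N + 1 ≠ 0 by positivity)
  have h3 : (1 : ℂ) - ((N / (N + 1) : ℝ) : ℂ) = 1 / (N + 1) := by
    rw [← Complex.ofReal_one, ← Complex.ofReal_sub, one_sub_ratio hN]; push_cast; rfl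
  rw [h3, mul_assoc, ← mul_div_assoc, ← Complex.exp_add, mul_div_assoc', mul_comm (1 / ((N : ℂ) + 1)),
    mul_div_assoc, div_self (by simpa using h1), mul_one, hx]
  congr 1
  push_cast
  field_simp
  ring

/-- The joint law of two independent Poisson variables of means `a` and `b`. -/
def poissonPair (a b : ℝ) (p : ℕ × ℕ) : ℝ :=
  Real.exp (-(a + b)) * (a ^ p.1 / (p.1.factorial : ℝ) * (b ^ p.2 / (p.2.factorial : ℝ)))

theorem summable_poissonPair {a b : ℝ} (ha : 0 < a) (hb : 0 < b) : Summable (poissonPair a b) :=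
  ((Real.summable_pow_div_factorial a).mul_of_nonneg (Real.summable_pow_div_factorial b)
    (fun _ => by positivity) (fun _ => by positivity)).mul_left _

theorem tsum_poissonPair_mul_zpow {a b : ℝ} (ha : 0 < a) (hb : 0 < b) (s : ℂ) (hs : ‖s‖ = 1) :
    ∑' p : ℕ × ℕ, (poissonPair a b p : ℂ) * s ^ ((p.1 : ℤ) - p.2)
      = Complex.exp (b * (s⁻¹ - 1) + a * (s - 1)) := by
  have hs0 : s ≠ 0 := by rintro rfl; simp at hs
  have hsumm : Summable fun p : ℕ × ℕ => (poissonPair a b p : ℂ) * s ^ ((p.1 : ℤ) - p.2) := by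
    refine Summable.of_norm ?_
    simpa [hs] using (summable_poissonPair ha hb).norm
  have h1 := (hsumm.hasSum).prod_fiberwise (fun m => (by
    have := (hasSum_cexp (b * s⁻¹)).mul_left (Complex.exp (-(a + b)) * ((a * s) ^ m / (m.factorial : ℂ)))
    convert! this using 1
    ext j
    rw [zpow_sub₀ hs0, zpow_natCast, zpow_natCast, poissonPair]
    push_cast
    rw [mul_pow, mul_pow, inv_pow]
    ring : HasSum (fun j : ℕ => (poissonPair a b (m, j) : ℂ) * s ^ ((m : ℤ) - j))
      (Complex.exp (-(a + b)) * ((a * s) ^ m / (m.factorial : ℂ)) * Complex.exp (b * s⁻¹))))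
  have h2 := ((hasSum_cexp (a * s)).mul_left (Complex.exp (-(a + b)))).mul_right (Complex.exp (b * s⁻¹))
  rw [h1.unique h2, ← Complex.exp_add, ← Complex.exp_add]
  congr 1
  ring

/-- The law of a difference of independent Poisson variables (Skellam law), read off from the Bessel
series. Since $z/2=c\sqrt{N(N+1)}$, the prefactor $(N/(N+1))^{k/2}$ turns $(z/2)^{|k|}$ into
$(cN)^k$ for $k\ge0$ and into $(c(N+1))^{|k|}$ for $k\le0$. -/
theorem qDist_eq_diffMarginal_poissonPair (N c : ℝ) (hN : 0 < N) (hc : 0 < c) (k : ℤ) :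
    qDist N c k = diffMarginal (poissonPair (c * N) (c * (N + 1))) k := by
  have hr : 0 < √N := Real.sqrt_pos.2 hN
  have ht : 0 < √(N + 1) := Real.sqrt_pos.2 (by positivity)
  have hr2 : √N * √N = N := Real.mul_self_sqrt hN.le
  have ht2 : √(N + 1) * √(N + 1) = N + 1 := Real.mul_self_sqrt (by positivity)
  have hpow : ∀ l : ℕ, (N / (N + 1)) ^ ((l : ℝ) / 2) = (√N / √(N + 1)) ^ l := by
    intro l
    rw [← Real.sqrt_div hN.le, Real.sqrt_eq_rpow, ← Real.rpow_natCast, ← Real.rpow_mul (by positivity)]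
    congr 1; ring
  have hz : 2 * c * √(N * (N + 1)) / 2 = c * (√N * √(N + 1)) := by
    rw [Real.sqrt_mul hN.le]; ring
  have hexp : -c * (2 * N + 1) = -(c * N + c * (N + 1)) := by ring
  have hsq : ∀ m : ℕ, (c * (√N * √(N + 1))) ^ (2 * m) = (c * N) ^ m * (c * (N + 1)) ^ m := by
    intro m
    rw [pow_mul, ← mul_pow]
    congr 1
    linear_combination (c ^ 2 * √(N + 1) * √(N + 1)) * hr2 + c ^ 2 * N * ht2
  rw [qDist, besselI, hz, hexp]
  rcases Int.eq_nat_or_neg k with ⟨l, rfl | rfl⟩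
  · have hl : (√N / √(N + 1)) ^ l * (c * (√N * √(N + 1))) ^ l = (c * N) ^ l := by
      rw [← mul_pow]; congr 1; field_simp; linear_combination hr2
    rw [diffMarginal, Int.natAbs_natCast, Int.cast_natCast, hpow,
      -- For $k=l\ge0$ only first coordinates at least $l$ contribute, so the index is shifted by
      -- $l$.
      ← (add_left_injective l).tsum_eq (f := fun m : ℕ => if (l : ℤ) ≤ m then
        poissonPair (c * N) (c * (N + 1)) (m, ((m : ℤ) - l).toNat) else 0)]
    · rw [mul_assoc, ← mul_assoc ((√N / √(N + 1)) ^ l), hl, ← tsum_mul_left, ← tsum_mul_left]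
      refine tsum_congr fun m => ?_
      rw [if_pos (by push_cast; omega), poissonPair, hsq, add_comm l m, pow_add]
      have : (((m + l : ℕ) : ℤ) - l).toNat = m := by push_cast; omega
      rw [this]
      field_simp
    · intro m hm
      rw [Function.mem_support] at hm
      by_cases h : (l : ℤ) ≤ m
      · exact ⟨m - l, by simp; omega⟩
      · simp [h] at hm
  · have hl : (N / (N + 1)) ^ (((-(l : ℤ) : ℤ) : ℝ) / 2) * (c * (√N * √(N + 1))) ^ l
        = (c * (N + 1)) ^ l := by
      push_cast
      rw [neg_div, Real.rpow_neg (by positivity), hpow, ← inv_pow, ← mul_pow]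
      congr 1; field_simp; linear_combination ht2
    rw [diffMarginal, Int.natAbs_neg, Int.natAbs_natCast, mul_assoc,
      ← mul_assoc ((N / (N + 1)) ^ (((-(l : ℤ) : ℤ) : ℝ) / 2)), hl, ← tsum_mul_left, ← tsum_mul_left]
    refine tsum_congr fun m => ?_
    have : ((m : ℤ) - (-l)).toNat = l + m := by omega
    rw [if_pos (by omega), poissonPair, hsq, this, pow_add]
    field_simp

theorem qDist_eq_diffMarginal (N c : ℝ) (hN : 0 < N) (hc : 0 < c) (k : ℤ) :
    qDist N c k = diffMarginal (jointDist N c) k := by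
  rw [qDist_eq_diffMarginal_poissonPair N c hN hc]
  refine diffMarginal_eq (summable_poissonPair (by positivity) (by positivity))
    (summable_jointDist N c hN hc) (fun s hs => ?_) k
  rw [tsum_poissonPair_mul_zpow (by positivity) (by positivity) s hs,
    tsum_jointDist_mul_zpow N c hN hc s hs]
  push_cast
  rfl

theorem qDist_nonneg (N c : ℝ) (hN : 0 < N) (hc : 0 < c) (k : ℤ) : 0 ≤ qDist N c k := by
  rw [qDist_eq_diffMarginal N c hN hc]
  exact diffMarginal_nonneg (jointDist_nonneg c hN) k

theorem hasSum_qDist (N c : ℝ) (hN : 0 < N) (hc : 0 < c) : HasSum (qDist N c) 1 := by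
  have h := hasSum_diffMarginal (summable_jointDist N c hN hc) (s := 1) (by simp)
  rw [tsum_jointDist_mul_zpow N c hN hc 1 (by simp)] at h
  simp only [one_zpow, mul_one, inv_one, sub_self, mul_zero, add_zero, Complex.exp_zero,
    ← qDist_eq_diffMarginal N c hN hc] at h
  rw [← Complex.hasSum_ofReal, Complex.ofReal_one]
  exact h

/-! ### Semicontinuity of the Shannon entropy -/

/-- The Fenchel–Young inequality $-x\ln x\le ax+e^{-a-1}$, a form of $1+y\le e^y$. With
$a=t\cdot\text{size}$ it compares $p$ with a Gibbs weight. -/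
theorem neg_mul_logb_le {x : ℝ} (hx : 0 ≤ x) (a : ℝ) :
    -(x * Real.logb 2 x) ≤ (a * x + Real.exp (-a - 1)) / Real.log 2 := by
  have h2 : 0 < Real.log 2 := Real.log_pos one_lt_two
  rw [Real.logb, le_div_iff₀ h2]
  have : -(x * (Real.log x / Real.log 2)) * Real.log 2 = -(x * Real.log x) := by field_simp
  rw [this]
  rcases hx.eq_or_lt with rfl | hx
  · simp; positivity
  · have h := Real.add_one_le_exp (-Real.log x - a - 1)
    have e : Real.exp (-a - 1) = x * Real.exp (-Real.log x - a - 1) := by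
      have := Real.exp_add (Real.log x) (-Real.log x - a - 1)
      rw [Real.exp_log hx] at this
      rw [← this]; congr 1; ring
    rw [e]
    nlinarith

/-- Outside the finite set $F$ the entropy is controlled by the moment bound times $t$ plus a tail
$\delta$ of Gibbs weights that does not depend on $p$; this gives uniformity along a sequence. -/
theorem shannonEntropy_le {ι : Type*} {p size : ι → ℝ} (hp : ∀ i, 0 ≤ p i) (hsize : ∀ i, 0 ≤ size i)
    {t C δ : ℝ} (ht : 0 ≤ t)
    (hC : ∀ s : Finset ι, ∑ i ∈ s, size i * p i ≤ C) (F : Finset ι)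
    (hδ : ∀ s : Finset ι, Disjoint s F → ∑ i ∈ s, Real.exp (-(t * size i) - 1) ≤ δ) :
    shannonEntropy p ≤ ∑ i ∈ F, ENNReal.ofReal (-(p i * Real.logb 2 (p i)))
      + ENNReal.ofReal ((t * C + δ) / Real.log 2) := by
  classical
  have h2 : 0 < Real.log 2 := Real.log_pos one_lt_two
  rw [shannonEntropy, ENNReal.tsum_eq_iSup_sum]
  refine iSup_le fun s => ?_
  rw [← Finset.sum_inter_add_sum_sdiff s F]
  refine add_le_add (Finset.sum_le_sum_of_subset Finset.inter_subset_right) ?_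
  -- No bound $p_i\le1$ is assumed, so a term may be negative; `ENNReal.ofReal` truncates it and the
  -- maximum mirrors this.
  have hnn : ∀ i, 0 ≤ max (-(p i * Real.logb 2 (p i))) 0 := fun i => le_max_right _ _
  have hb : ∀ i, max (-(p i * Real.logb 2 (p i))) 0 ≤
      (t * (size i * p i) + Real.exp (-(t * size i) - 1)) / Real.log 2 := by
    intro i
    refine max_le ((neg_mul_logb_le (hp i) (t * size i)).trans ?_) ?_
    · rw [mul_assoc]
    · have := mul_nonneg (hsize i) (hp i)
      positivity
  calc ∑ i ∈ s \ F, ENNReal.ofReal (-(p i * Real.logb 2 (p i)))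
      = ENNReal.ofReal (∑ i ∈ s \ F, max (-(p i * Real.logb 2 (p i))) 0) := by
        rw [ENNReal.ofReal_sum_of_nonneg fun i _ => hnn i]
        refine Finset.sum_congr rfl fun i _ => ?_
        rw [ENNReal.ofReal_max]; simp
    _ ≤ _ := by
        refine ENNReal.ofReal_le_ofReal ((Finset.sum_le_sum fun i _ => hb i).trans ?_)
        rw [← Finset.sum_div, Finset.sum_add_distrib, ← Finset.mul_sum]
        gcongr
        · exact hC _
        · exact hδ _ Finset.sdiff_disjoint

theorem shannonEntropy_ne_top {ι : Type*} {p size : ι → ℝ} (hp : ∀ i, 0 ≤ p i)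
    (hsize : ∀ i, 0 ≤ size i) {C : ℝ}
    (hC : ∀ s : Finset ι, ∑ i ∈ s, size i * p i ≤ C)
    (hs : Summable fun i => Real.exp (-size i)) : shannonEntropy p ≠ ⊤ := by
  have hs' : Summable fun i => Real.exp (-(1 * size i) - 1) := by
    refine (hs.mul_right (Real.exp (-1))).congr fun i => ?_
    rw [← Real.exp_add]; congr 1; ring
  refine ne_top_of_le_ne_top ?_ (shannonEntropy_le hp hsize (t := 1) zero_le_one hC ∅
    (δ := ∑' i, Real.exp (-(1 * size i) - 1)) fun s _ => hs'.sum_le_tsum s fun _ _ => by positivity)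
  simp

theorem continuous_neg_mul_logb : Continuous fun x : ℝ => -(x * Real.logb 2 x) := by
  have : (fun x : ℝ => -(x * Real.logb 2 x)) = fun x => -(x * Real.log x) / Real.log 2 := by
    ext x; rw [Real.logb]; ring
  rw [this]
  exact (Real.continuous_mul_log.neg).div_const _

theorem tendsto_sum_entropy {ι : Type*} {p : ℕ → ι → ℝ} {p₀ : ι → ℝ}
    (hlim : ∀ i, Tendsto (fun n => p n i) atTop (𝓝 (p₀ i))) (F : Finset ι) :
    Tendsto (fun n => ∑ i ∈ F, ENNReal.ofReal (-(p n i * Real.logb 2 (p n i)))) atTop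
      (𝓝 (∑ i ∈ F, ENNReal.ofReal (-(p₀ i * Real.logb 2 (p₀ i))))) :=
  tendsto_finsetSum _ fun i _ => (ENNReal.continuous_ofReal.tendsto _).comp
    ((continuous_neg_mul_logb.tendsto _).comp (hlim i))

/-- The Shannon entropy is upper semicontinuous under a moment constraint. -/
theorem eventually_shannonEntropy_le {ι : Type*} {p : ℕ → ι → ℝ} {p₀ size : ι → ℝ} {C : ℝ}
    (hp : ∀ n i, 0 ≤ p n i) (hsize : ∀ i, 0 ≤ size i)
    (hC : ∀ᶠ n in atTop, ∀ s : Finset ι, ∑ i ∈ s, size i * p n i ≤ C)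
    (hs : ∀ t : ℝ, 0 < t → Summable fun i => Real.exp (-(t * size i)))
    (hlim : ∀ i, Tendsto (fun n => p n i) atTop (𝓝 (p₀ i))) {ε : ℝ} (hε : 0 < ε) :
    ∀ᶠ n in atTop, shannonEntropy (p n) ≤ shannonEntropy p₀ + ENNReal.ofReal ε := by
  have h2 : 0 < Real.log 2 := Real.log_pos one_lt_two
  -- The order of choices matters: $t$ makes the moment term at most $\varepsilon'$, and $F$ is then
  -- chosen to make the Gibbs tail for that $t$ at most $\varepsilon'$. Together they cost
  -- $\varepsilon/2$ in bits; the other half pays for convergence on $F$.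
  set ε' := ε * Real.log 2 / 4 with hε'
  have hε'0 : 0 < ε' := by positivity
  set t := ε' / (|C| + 1) with ht
  have ht0 : 0 < t := by positivity
  have hs' : Summable fun i => Real.exp (-(t * size i) - 1) := by
    refine ((hs t ht0).mul_right (Real.exp (-1))).congr fun i => ?_
    rw [← Real.exp_add]; congr 1
  obtain ⟨F, hF⟩ := summable_iff_vanishing_norm.1 hs' ε' hε'0
  have hlt : ∑ i ∈ F, ENNReal.ofReal (-(p₀ i * Real.logb 2 (p₀ i)))
      < ∑ i ∈ F, ENNReal.ofReal (-(p₀ i * Real.logb 2 (p₀ i))) + ENNReal.ofReal (ε / 2) :=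
    ENNReal.lt_add_right (by simp) (by simpa using hε)
  filter_upwards [hC, (tendsto_sum_entropy hlim F).eventually (gt_mem_nhds hlt)] with n hCn hn
  refine (shannonEntropy_le (hp n) hsize ht0.le hCn F (δ := ε') fun s hd =>
    (le_abs_self _).trans (hF s hd).le).trans ?_
  have hle : (t * C + ε') / Real.log 2 ≤ ε / 2 := by
    rw [div_le_iff₀ h2]
    have : t * C ≤ ε' := by
      rw [ht, div_mul_eq_mul_div, div_le_iff₀ (by positivity)]
      nlinarith [le_abs_self C]
    rw [hε'] at this ⊢
    linarith
  calc _ ≤ (∑ i ∈ F, ENNReal.ofReal (-(p₀ i * Real.logb 2 (p₀ i))) + ENNReal.ofReal (ε / 2))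
        + ENNReal.ofReal (ε / 2) := add_le_add hn.le (ENNReal.ofReal_le_ofReal hle)
    _ = ∑ i ∈ F, ENNReal.ofReal (-(p₀ i * Real.logb 2 (p₀ i))) + ENNReal.ofReal ε := by
        rw [add_assoc, ← ENNReal.ofReal_add (by positivity) (by positivity), add_halves]
    _ ≤ _ := by gcongr; exact ENNReal.sum_le_tsum F

/-- The Shannon entropy is lower semicontinuous. -/
theorem eventually_lt_shannonEntropy {ι : Type*} {p : ℕ → ι → ℝ} {p₀ : ι → ℝ}
    (hlim : ∀ i, Tendsto (fun n => p n i) atTop (𝓝 (p₀ i))) {b : ℝ≥0∞} (hb : b < shannonEntropy p₀) :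
    ∀ᶠ n in atTop, b < shannonEntropy (p n) := by
  rw [shannonEntropy, ENNReal.tsum_eq_iSup_sum, lt_iSup_iff] at hb
  obtain ⟨F, hF⟩ := hb
  filter_upwards [(tendsto_sum_entropy hlim F).eventually (lt_mem_nhds hF)] with n hn
  exact hn.trans_le (ENNReal.sum_le_tsum F)

theorem shannonEntropy_comp_injective {ι κ : Type*} {g : ι → κ} (hg : Function.Injective g)
    (p : κ → ℝ) (hp : ∀ k ∉ Set.range g, p k = 0) :
    shannonEntropy (fun i => p (g i)) = shannonEntropy p := by
  refine hg.tsum_eq (f := fun k => ENNReal.ofReal (-(p k * Real.logb 2 (p k)))) fun k hk => ?_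
  by_contra h
  rw [Function.mem_support, hp k h] at hk
  simp at hk

theorem sub_le_liminf_sub {a b : ℕ → ℝ≥0∞} {A B : ℝ≥0∞} (hA : A ≠ ⊤) (hB : B ≠ ⊤)
    (ha : ∀ x < A, ∀ᶠ n in atTop, x < a n)
    (hb : ∀ ε : ℝ, 0 < ε → ∀ᶠ n in atTop, b n ≤ B + ENNReal.ofReal ε) :
    (A : EReal) - (B : EReal) ≤ liminf (fun n => (a n : EReal) - (b n : EReal)) atTop := by
  lift A to NNReal using hA
  lift B to NNReal using hB
  refine le_of_forall_lt fun x hx => ?_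
  obtain ⟨r, hxr, hr⟩ := EReal.lt_iff_exists_real_btwn.1 hx
  refine hxr.trans_le ?_
  have hr' : r < (A : ℝ) - B := by
    have : ((A : ℝ≥0∞) : EReal) - ((B : ℝ≥0∞) : EReal) = (((A : ℝ) - B : ℝ) : EReal) := by
      rw [EReal.coe_sub]; rfl
    rw [this] at hr
    exact_mod_cast hr
  set ε := ((A : ℝ) - B - r) / 2 with hε
  have hε0 : 0 < ε := by linarith
  have h1 : ∀ᶠ n in atTop, (((A : ℝ) - ε : ℝ) : EReal) ≤ a n := by
    -- When $A-\varepsilon<0$ the bound is trivial, and `ENNReal.ofReal` would lose the value.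
    rcases lt_or_ge ((A : ℝ) - ε) 0 with h | h
    · exact Eventually.of_forall fun n =>
        (EReal.coe_le_coe_iff.2 h.le).trans (EReal.coe_ennreal_nonneg _)
    · have hlt : ENNReal.ofReal ((A : ℝ) - ε) < A := by
        rw [ENNReal.ofReal_lt_iff_lt_toReal h (by simp)]
        simp [hε0]
      filter_upwards [ha _ hlt] with n hn
      have := EReal.coe_ennreal_le_coe_ennreal_iff.2 hn.le
      rwa [EReal.coe_ennreal_ofReal, max_eq_left h] at this
  refine le_liminf_of_le (by isBoundedDefault) ?_
  filter_upwards [h1, hb ε hε0] with n h1 h2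
  have h3 := EReal.coe_ennreal_le_coe_ennreal_iff.2 h2
  rw [EReal.coe_ennreal_add, EReal.coe_ennreal_ofReal, max_eq_left hε0.le] at h3
  have h4 := EReal.sub_le_sub h1 h3
  refine le_trans (le_of_eq ?_) h4
  have : (((B : ℝ≥0∞) : EReal) + (ε : EReal)) = (((B : ℝ) + ε : ℝ) : EReal) := by
    rw [EReal.coe_add]; rfl
  rw [this, ← EReal.coe_sub]
  congr 1
  rw [hε]; ring

/-! ### Output distributions of the beam splitter -/

/-- Distribution of the number of photons in the second output mode of the beam splitter, for a
thermal state and the Fock state `|n⟩` as inputs. -/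
def envDist (N θ : ℝ) (n e : ℕ) : ℝ := ∑' m, thermalWeight N m * transProb θ n m e

/-- Distribution of the number of photons in the first output mode. -/
def outDist (N θ : ℝ) (n i : ℕ) : ℝ :=
  ∑' m, if i ≤ m + n then thermalWeight N m * transProb θ n m (m + n - i) else 0

theorem summable_envDist {N : ℝ} (hN : 0 < N) (θ : ℝ) (n e : ℕ) :
    Summable fun m => thermalWeight N m * transProb θ n m e :=
  (hasSum_thermalWeight hN).summable.of_nonneg_of_le
    (fun m => mul_nonneg (thermalWeight_nonneg hN m) (transProb_nonneg _ _ _ _))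
    (fun m => mul_le_of_le_one_right (thermalWeight_nonneg hN m) (transProb_le_one _ _ _ _))

theorem envDist_nonneg {N : ℝ} (hN : 0 < N) (θ : ℝ) (n e : ℕ) : 0 ≤ envDist N θ n e :=
  tsum_nonneg fun m => mul_nonneg (thermalWeight_nonneg hN m) (transProb_nonneg _ _ _ _)

/-- The first moment bound for fixed $m$, averaged over the thermal law of mean $N$. -/
theorem sum_mul_envDist_le {N : ℝ} (hN : 0 < N) (θ : ℝ) (n : ℕ) (s : Finset ℕ) :
    ∑ e ∈ s, (e : ℝ) * envDist N θ n e ≤ 2 * (Real.cos θ ^ 2 * n) + 2 * N := by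
  have h1 := hasSum_sum (s := s) fun e _ => (summable_envDist hN θ n e).hasSum.mul_left (e : ℝ)
  have h2 := ((hasSum_thermalWeight hN).mul_left (2 * (Real.cos θ ^ 2 * n))).add
    ((hasSum_mul_thermalWeight hN).mul_left 2)
  rw [mul_one] at h2
  refine hasSum_le (fun m => ?_) h1 h2
  have := mul_le_mul_of_nonneg_left (sum_mul_transProb_le θ n m s) (thermalWeight_nonneg hN m)
  rw [Finset.mul_sum] at this
  calc _ = ∑ e ∈ s, thermalWeight N m * ((e : ℝ) * transProb θ n m e) :=
        Finset.sum_congr rfl fun e _ => by ring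
    _ ≤ _ := this
    _ = _ := by ring

theorem tendsto_envDist {N c : ℝ} (hN : 0 < N) (hc : 0 < c) (e : ℕ) :
    Tendsto (fun n : ℕ => envDist N (Real.arccos √(c / n)) n e) atTop (𝓝 (pDist N c e)) := by
  rw [← (hasSum_jointDist_left N c hN hc e).tsum_eq]
  refine tendsto_tsum_of_dominated_convergence (hasSum_thermalWeight hN).summable
    (fun m => (tendsto_transProb c hc m e).const_mul _) (Eventually.of_forall fun n m => ?_)
  rw [Real.norm_eq_abs, abs_of_nonneg (mul_nonneg (thermalWeight_nonneg hN m) (transProb_nonneg _ _ _ _))]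
  exact mul_le_of_le_one_right (thermalWeight_nonneg hN m) (transProb_le_one _ _ _ _)

/-- The law of the change of the number of photons in the first output mode. -/
def shiftedOutDist (N θ : ℝ) (n : ℕ) (k : ℤ) : ℝ :=
  if 0 ≤ n + k then outDist N θ n (n + k).toNat else 0

/-- The output photon number escapes to infinity with $n$, so it is centred: $k=i-n=m-e$. For
$n\ge|k|$ the weight is a sum over $m\ge k$ with $e=m-k$, and the thermal weights dominate the
limit. -/
theorem tendsto_shiftedOutDist {N c : ℝ} (hN : 0 < N) (hc : 0 < c) (k : ℤ) :
    Tendsto (fun n : ℕ => shiftedOutDist N (Real.arccos √(c / n)) n k) atTop (𝓝 (qDist N c k)) := by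
  rw [qDist_eq_diffMarginal N c hN hc]
  have h : Tendsto (fun n : ℕ => ∑' m : ℕ, if k ≤ m then thermalWeight N m
      * transProb (Real.arccos √(c / n)) n m ((m : ℤ) - k).toNat else 0) atTop
      (𝓝 (diffMarginal (jointDist N c) k)) := by
    refine tendsto_tsum_of_dominated_convergence (hasSum_thermalWeight hN).summable
      (fun m => ?_) (Eventually.of_forall fun n m => ?_)
    · split_ifs
      · exact (tendsto_transProb c hc m _).const_mul _
      · exact tendsto_const_nhds
    · split_ifs
      · rw [Real.norm_eq_abs,
          abs_of_nonneg (mul_nonneg (thermalWeight_nonneg hN m) (transProb_nonneg _ _ _ _))]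
        exact mul_le_of_le_one_right (thermalWeight_nonneg hN m) (transProb_le_one _ _ _ _)
      · simpa using thermalWeight_nonneg hN m
  refine h.congr' ?_
  filter_upwards [eventually_ge_atTop k.natAbs] with n hn
  rw [shiftedOutDist, if_pos (by omega), outDist]
  refine tsum_congr fun m => ?_
  by_cases hk : k ≤ m
  · rw [if_pos hk, if_pos (by omega)]
    congr 2; omega
  · rw [if_neg hk, if_neg (by omega)]

theorem eventually_cos_sq (c : ℝ) (hc : 0 < c) :
    ∀ᶠ n : ℕ in atTop, Real.cos (Real.arccos √(c / n)) ^ 2 * n = c := by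
  filter_upwards [eventually_cos_sin_arccos c hc] with n hn
  obtain ⟨h0, h1, h2, h3⟩ := hn
  rw [h2, Real.sq_sqrt (by positivity)]
  field_simp

/-! ### First moments and finite entropy of the limit laws. -/

theorem sum_mul_pDist_le {N c : ℝ} (hN : 0 < N) (hc : 0 < c) (s : Finset ℕ) :
    ∑ e ∈ s, (e : ℝ) * pDist N c e ≤ 2 * c + 2 * N := by
  refine le_of_tendsto (tendsto_finsetSum s fun e _ => (tendsto_envDist hN hc e).const_mul (e : ℝ)) ?_
  filter_upwards [eventually_cos_sq c hc] with n hn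
  simpa only [hn] using sum_mul_envDist_le hN (Real.arccos √(c / n)) n s

theorem sum_displacement_sq_le {c : ℝ} (hc : 0 < c) (m : ℕ) (s : Finset ℕ) :
    ∑ e ∈ s, displacement c m e ^ 2 ≤ 1 :=
  le_of_tendsto (tendsto_finsetSum s fun e _ => tendsto_transProb c hc m e)
    (Eventually.of_forall fun n => sum_transProb_le _ n m s)

theorem sum_mul_displacement_sq_le {c : ℝ} (hc : 0 < c) (m : ℕ) (s : Finset ℕ) :
    ∑ e ∈ s, (e : ℝ) * displacement c m e ^ 2 ≤ 2 * c + 2 * m := by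
  refine le_of_tendsto (tendsto_finsetSum s fun e _ =>
    (tendsto_transProb c hc m e).const_mul (e : ℝ)) ?_
  filter_upwards [eventually_cos_sq c hc] with n hn
  simpa only [hn] using sum_mul_transProb_le (Real.arccos √(c / n)) n m s

theorem summable_mul_jointDist {N c : ℝ} (hN : 0 < N) (hc : 0 < c) :
    Summable fun p : ℕ × ℕ => ((p.1 : ℝ) + p.2) * jointDist N c p := by
  have hnn : ∀ p : ℕ × ℕ, 0 ≤ ((p.1 : ℝ) + p.2) * jointDist N c p := fun p =>
    mul_nonneg (by positivity) (jointDist_nonneg c hN p)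
  have hb : ∀ m : ℕ, ∀ s : Finset ℕ, ∑ e ∈ s, ((m : ℝ) + e) * jointDist N c (m, e)
      ≤ 3 * (m * thermalWeight N m) + 2 * c * thermalWeight N m := by
    intro m s
    have h1 := mul_le_mul_of_nonneg_left (sum_displacement_sq_le hc m s) (Nat.cast_nonneg (α := ℝ) m)
    have h2 := mul_le_mul_of_nonneg_left (add_le_add h1 (sum_mul_displacement_sq_le hc m s))
      (thermalWeight_nonneg hN m)
    rw [Finset.mul_sum, ← Finset.sum_add_distrib, Finset.mul_sum] at h2
    calc _ = ∑ e ∈ s, thermalWeight N m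
          * (m * displacement c m e ^ 2 + e * displacement c m e ^ 2) :=
          Finset.sum_congr rfl fun e _ => by rw [jointDist]; ring
      _ ≤ _ := h2
      _ = _ := by ring
  have hs : ∀ m : ℕ, Summable fun e : ℕ => ((m : ℝ) + e) * jointDist N c (m, e) := fun m =>
    summable_of_sum_le (fun e => hnn (m, e)) (hb m)
  rw [summable_prod_of_nonneg hnn]
  refine ⟨hs, ?_⟩
  refine (((hasSum_mul_thermalWeight hN).summable.mul_left 3).add
    ((hasSum_thermalWeight hN).summable.mul_left (2 * c))).of_nonneg_of_le
    (fun m => tsum_nonneg fun e => hnn (m, e)) fun m => ?_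
  exact (hs m).tsum_le_of_sum_le (hb m)

/-- From $|m-e|\le m+e$ and the finite first moments of the joint law. -/
theorem exists_sum_mul_qDist_le {N c : ℝ} (hN : 0 < N) (hc : 0 < c) :
    ∃ C : ℝ, ∀ s : Finset ℤ, ∑ k ∈ s, |(k : ℝ)| * qDist N c k ≤ C := by
  have hJ := summable_mul_jointDist hN hc
  have hnn : ∀ p : ℕ × ℕ, 0 ≤ ((p.1 : ℝ) + p.2) * jointDist N c p := fun p =>
    mul_nonneg (by positivity) (jointDist_nonneg c hN p)
  have hs : Summable (diffMarginal fun p : ℕ × ℕ => ((p.1 : ℝ) + p.2) * jointDist N c p) := by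
    have := (hasSum_diffMarginal hJ (s := 1) (by simp)).summable
    simpa [Complex.summable_ofReal] using this
  refine ⟨_, fun s => (Finset.sum_le_sum fun k _ => ?_).trans
    (hs.sum_le_tsum s fun k _ => diffMarginal_nonneg hnn k)⟩
  rw [qDist_eq_diffMarginal N c hN hc, diffMarginal, diffMarginal, ← tsum_mul_left]
  refine ((summable_diff_extend (summable_jointDist N c hN hc)).prod_factor k).mul_left _
    |>.tsum_le_tsum (fun m => ?_) ((summable_diff_extend hJ).prod_factor k)
  simp only
  split_ifs with h
  · refine mul_le_mul_of_nonneg_right ?_ (jointDist_nonneg c hN _)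
    have e : ((((m : ℤ) - k).toNat : ℕ) : ℝ) = m - k := by
      have : ((((m : ℤ) - k).toNat : ℕ) : ℤ) = m - k := Int.toNat_of_nonneg (by omega)
      exact_mod_cast congrArg (fun z : ℤ => (z : ℝ)) this
    rw [e, abs_le]
    have h' : (k : ℝ) ≤ m := by exact_mod_cast h
    constructor <;> linarith [Nat.cast_nonneg (α := ℝ) m]
  · simp

theorem summable_exp_neg_mul_nat {t : ℝ} (ht : 0 < t) :
    Summable fun k : ℕ => Real.exp (-(t * (k : ℝ))) := by
  have := Real.summable_exp_nat_mul_iff.2 (neg_lt_zero.2 ht)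
  refine this.congr fun k => ?_
  congr 1; ring

theorem shannonEntropy_pDist (N c : ℝ) :
    shannonEntropy (fun k : ℕ => pDist N c k) = shannonEntropy (pDist N c) := by
  refine shannonEntropy_comp_injective (g := ((↑) : ℕ → ℤ)) Nat.cast_injective _ fun k hk => ?_
  rw [pDist, if_neg]
  intro h0
  exact hk ⟨k.toNat, Int.toNat_of_nonneg h0⟩

theorem shannonEntropy_shiftedOutDist (N θ : ℝ) (n : ℕ) :
    shannonEntropy (shiftedOutDist N θ n) = shannonEntropy (outDist N θ n) := by
  rw [← shannonEntropy_comp_injective (g := fun i : ℕ => (i : ℤ) - n) (fun a b h => by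
    simpa using h) (shiftedOutDist N θ n)]
  · congr 1
    ext i
    rw [shiftedOutDist, if_pos (by omega)]
    congr 1; omega
  · intro k hk
    rw [shiftedOutDist, if_neg]
    intro h0
    exact hk ⟨(n + k).toNat, by simp only; omega⟩

theorem shannonEntropy_pDist_ne_top {N c : ℝ} (hN : 0 < N) (hc : 0 < c) :
    shannonEntropy (pDist N c) ≠ ⊤ := by
  rw [← shannonEntropy_pDist]
  exact shannonEntropy_ne_top (fun k => pDist_nonneg N c hN hc k)
    (size := fun k : ℕ => (k : ℝ)) (fun k => by positivity) (sum_mul_pDist_le hN hc)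
    (by simpa using summable_exp_neg_mul_nat one_pos)

theorem shannonEntropy_qDist_ne_top {N c : ℝ} (hN : 0 < N) (hc : 0 < c) :
    shannonEntropy (qDist N c) ≠ ⊤ := by
  obtain ⟨C, hC⟩ := exists_sum_mul_qDist_le hN hc
  refine shannonEntropy_ne_top (qDist_nonneg N c hN hc) (fun k => abs_nonneg _) hC ?_
  have h := summable_exp_neg_mul_nat one_pos
  refine Summable.of_nat_of_neg (f := fun k : ℤ => Real.exp (-|(k : ℝ)|)) ?_ ?_ <;> simpa using h

/-- The output entropy enters with a plus sign and needs only lower semicontinuity. The environment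
entropy enters with a minus sign and needs the moment bound $2c+2N$, valid for large $n$. -/
theorem liminf_entropy_sub {N c : ℝ} (hN : 0 < N) (hc : 0 < c) :
    (shannonEntropy (qDist N c) : EReal) - (shannonEntropy (pDist N c) : EReal)
      ≤ liminf (fun n : ℕ => (shannonEntropy (outDist N (Real.arccos √(c / n)) n) : EReal)
        - (shannonEntropy (envDist N (Real.arccos √(c / n)) n) : EReal)) atTop := by
  refine sub_le_liminf_sub (shannonEntropy_qDist_ne_top hN hc) (shannonEntropy_pDist_ne_top hN hc)
    (fun x hx => ?_) (fun ε hε => ?_)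
  · simp_rw [← shannonEntropy_shiftedOutDist]
    exact eventually_lt_shannonEntropy (tendsto_shiftedOutDist hN hc) hx
  · rw [← shannonEntropy_pDist]
    refine eventually_shannonEntropy_le (p := fun n : ℕ => envDist N (Real.arccos √(c / n)) n)
      (size := fun e : ℕ => (e : ℝ)) (C := 2 * c + 2 * N)
      (fun n => envDist_nonneg hN _ n) (fun e => by positivity) ?_ (fun t ht => summable_exp_neg_mul_nat ht)
      (tendsto_envDist hN hc) hε
    filter_upwards [eventually_cos_sq c hc] with n hn s
    simpa only [hn] using sum_mul_envDist_le hN (Real.arccos √(c / n)) n s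

/-! ### Entropy of diagonalisable operators -/

theorem mem_spectrum_of_apply_eq {H : Type*} [NormedAddCommGroup H] [InnerProductSpace ℂ H] {A : H →L[ℂ] H} {v : H} {μ : ℝ} (hv : v ≠ 0)
    (h : A v = (μ : ℂ) • v) : μ ∈ spectrum ℝ A := by
  rw [spectrum.mem_iff]
  rintro ⟨u, hu⟩
  have h1 : (u : H →L[ℂ] H) v = 0 := by
    rw [hu, Algebra.algebraMap_eq_smul_one]
    simp [h]
  have h2 : ((↑u⁻¹ : H →L[ℂ] H) * (u : H →L[ℂ] H)) v = v := by simp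
  have h3 : (↑u⁻¹ : H →L[ℂ] H) ((u : H →L[ℂ] H) v) = v := h2
  rw [h1, map_zero] at h3
  exact hv h3.symm

/-- The continuous functional calculus acts on eigenvectors. -/
theorem cfc_apply_eigenvector {H : Type*} [NormedAddCommGroup H] [InnerProductSpace ℂ H]
    [CompleteSpace H] {A : H →L[ℂ] H} (hA : IsSelfAdjoint A) {v : H} {μ : ℝ}
    (h : A v = (μ : ℂ) • v) {f : ℝ → ℝ} (hf : Continuous f) : cfc f A v = (f μ : ℂ) • v := by
  by_cases hv : v = 0
  · simp [hv]
  have hμ := mem_spectrum_of_apply_eq hv h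
  rw [cfc_apply f A hA hf.continuousOn]
  -- The claim holds for constants and the identity, is stable under sums and products, and is
  -- closed in $g$; polynomials being dense, it holds for every continuous $g$.
  suffices key : ∀ g : C(spectrum ℝ A, ℝ), cfcHom hA g v = (g ⟨μ, hμ⟩ : ℂ) • v from key _
  intro g
  induction g using ContinuousMap.induction_on_of_compact with
  | const r =>
    have : ContinuousMap.const (spectrum ℝ A) r = algebraMap ℝ C(spectrum ℝ A, ℝ) r := rfl
    rw [this, AlgHomClass.commutes, Algebra.algebraMap_eq_smul_one]
    simp
  | id => rw [cfcHom_id]; exact h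
  | star_id => rw [map_star, cfcHom_id, hA.star_eq]; exact h
  | add f g hf hg => rw [map_add]; simp [hf, hg, add_smul]
  | mul f g hf hg =>
    have : cfcHom hA (f * g) v = cfcHom hA f (cfcHom hA g v) := by rw [map_mul]; rfl
    rw [this, hg, map_smul, hf, smul_smul, mul_comm, ContinuousMap.mul_apply, Complex.ofReal_mul]
  | frequently f hfr =>
    have hcl : IsClosed {g : C(spectrum ℝ A, ℝ) | cfcHom hA g v = (g ⟨μ, hμ⟩ : ℂ) • v} := by
      refine isClosed_eq ?_ ?_
      · exact (ContinuousLinearMap.apply ℂ H v).continuous.comp (cfcHom_continuous hA)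
      · exact (Complex.continuous_ofReal.comp (continuous_eval_const _)).smul
          continuous_const
    exact hfr.mem_of_closed hcl

theorem inner_ket {ι : Type*} (i : ι) (x : ℓ²(ι, ℂ)) : inner ℂ (ket i) x = x i := by
  classical
  simp [ket, lp.inner_single_left]

theorem hasSum_ket {ι : Type*} (x : ℓ²(ι, ℂ)) : HasSum (fun i => x i • ket i) x := by
  classical
  convert! lp.hasSum_single (p := 2) (by simp) x using 1
  ext i
  rw [ket, ← lp.single_smul]
  simp

theorem op_ext {ι κ : Type*} {A B : ℓ²(ι, ℂ) →L[ℂ] ℓ²(κ, ℂ)} (h : ∀ i, A (ket i) = B (ket i)) :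
    A = B := by
  ext1 x
  have h1 := A.hasSum (hasSum_ket x)
  have h2 := B.hasSum (hasSum_ket x)
  simp only [map_smul, h] at h1 h2
  exact h1.unique h2

/-- The von Neumann entropy computed in an eigenbasis. -/
theorem vonNeumannEntropy_eq_of_hilbertBasis {ι υ : Type*} {B : Op ι} (hB : IsSelfAdjoint B)
    (b : HilbertBasis υ ℂ ℓ²(ι, ℂ)) {p : υ → ℝ} (h : ∀ u, B (b u) = (p u : ℂ) • b u)
    (h0 : ∀ u, 0 ≤ p u) (h1 : ∀ u, p u ≤ 1) : vonNeumannEntropy B = shannonEntropy p := by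
  set f : ℝ → ℝ := fun x => -(x * Real.logb 2 x) with hf
  have hF : ∀ u, negMulLog B (b u) = (f (p u) : ℂ) • b u := fun u =>
    cfc_apply_eigenvector hB (h u) continuous_neg_mul_logb
  have hsa : IsSelfAdjoint (negMulLog B) := cfc_predicate _ _
  have hfnn : ∀ u, 0 ≤ f (p u) := by
    intro u
    have := Real.logb_nonpos one_lt_two (h0 u) (h1 u)
    have := mul_nonpos_of_nonneg_of_nonpos (h0 u) this
    simp only [hf]; linarith
  have hsum : ∀ i : ι, HasSum (fun u => f (p u) * ‖b u i‖ ^ 2)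
      (RCLike.re (inner ℂ (ket i) (negMulLog B (ket i)))) := by
    intro i
    have h := (Complex.hasSum_re (b.hasSum_inner_mul_inner (ket i) (negMulLog B (ket i))))
    convert! h using 1
    ext u
    have hsym : inner ℂ (b u) (negMulLog B (ket i)) = inner ℂ (negMulLog B (b u)) (ket i) :=
      (hsa.isSymmetric (b u) (ket i)).symm
    rw [hsym, hF, inner_smul_left, inner_ket,
      ← inner_conj_symm, inner_ket, Complex.conj_ofReal]
    rw [mul_left_comm, Complex.mul_conj', Complex.re_ofReal_mul]
    congr 1
    exact_mod_cast (Complex.ofReal_re _).symm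
  rw [vonNeumannEntropy, shannonEntropy]
  -- Tonelli exchanges the trace in the standard basis for the trace in the eigenbasis; $0\le
  -- p_u\le1$ makes all terms nonnegative.
  calc _ = ∑' i, ∑' u, ENNReal.ofReal (f (p u) * ‖b u i‖ ^ 2) := by
        refine tsum_congr fun i => ?_
        rw [← (hsum i).tsum_eq, ENNReal.ofReal_tsum_of_nonneg
          (fun u => mul_nonneg (hfnn u) (by positivity)) (hsum i).summable]
    _ = ∑' u, ∑' i, ENNReal.ofReal (f (p u) * ‖b u i‖ ^ 2) := ENNReal.tsum_comm
    _ = _ := by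
        refine tsum_congr fun u => ?_
        rw [← ENNReal.ofReal_tsum_of_nonneg (fun i => mul_nonneg (hfnn u) (by positivity))
          ((hasSum_sq (b u)).summable.mul_left _), tsum_mul_left, (hasSum_sq (b u)).tsum_eq,
          b.orthonormal.1 u]
        simp [hf]

/-- The von Neumann entropy of a diagonal operator. -/
theorem vonNeumannEntropy_eq_of_ket {ι : Type*} {B : Op ι} (hB : IsSelfAdjoint B) {p : ι → ℝ}
    (h : ∀ i, B (ket i) = (p i : ℂ) • ket i) (h0 : ∀ i, 0 ≤ p i) (h1 : ∀ i, p i ≤ 1) :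
    vonNeumannEntropy B = shannonEntropy p := by
  classical
  have hb : ∀ i, (⟨LinearIsometryEquiv.refl ℂ ℓ²(ι, ℂ)⟩ : HilbertBasis ι ℂ ℓ²(ι, ℂ)) i = ket i :=
    fun i => by rfl
  exact vonNeumannEntropy_eq_of_hilbertBasis hB ⟨LinearIsometryEquiv.refl ℂ ℓ²(ι, ℂ)⟩
    (fun u => by rw [hb]; exact h u) h0 h1

theorem proj_apply {ι : Type*} (x y : ℓ²(ι, ℂ)) : proj x y = inner ℂ x y • x := rfl

theorem isSelfAdjoint_proj {ι : Type*} (x : ℓ²(ι, ℂ)) : IsSelfAdjoint (proj x) := by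
  rw [ContinuousLinearMap.isSelfAdjoint_iff', proj, InnerProductSpace.adjoint_rankOne]

theorem norm_proj {ι : Type*} (x : ℓ²(ι, ℂ)) : ‖proj x‖ = ‖x‖ ^ 2 := by
  rw [proj, InnerProductSpace.norm_rankOne, sq]

/-- The von Neumann entropy of a mixture of orthogonal vectors. -/
theorem vonNeumannEntropy_eq_of_orthogonal {ι ε : Type*} {W : ε → ℓ²(ι, ℂ)} {B : Op ι}
    (hW : ∀ e e', e ≠ e' → inner ℂ (W e) (W e') = 0) (hB : HasSum (fun e => proj (W e)) B)
    (h1 : ∀ e, ‖W e‖ ^ 2 ≤ 1) : vonNeumannEntropy B = shannonEntropy (fun e => ‖W e‖ ^ 2) := by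
  have hsa : IsSelfAdjoint B := by
    have := hB.star
    simp only [(isSelfAdjoint_proj _).star_eq] at this
    exact this.unique hB
  have happ : ∀ x, HasSum (fun e => inner ℂ (W e) x • W e) (B x) := fun x =>
    hB.mapL (ContinuousLinearMap.apply ℂ _ x)
  have hBW : ∀ e, B (W e) = ((‖W e‖ ^ 2 : ℝ) : ℂ) • W e := by
    intro e
    have h := hasSum_single (f := fun e' => inner ℂ (W e') (W e) • W e') e
      (fun e' he => by rw [hW e' e he, zero_smul])
    rw [(happ (W e)).unique h, inner_self_eq_norm_sq_to_K]
    simp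
  set S := {e : ε | W e ≠ 0} with hS
  set w : S → ℓ²(ι, ℂ) := fun e => ((‖W e‖⁻¹ : ℝ) : ℂ) • W e with hw
  have hworth : Orthonormal ℂ w := by
    constructor
    · rintro ⟨e, he⟩
      have : ‖W e‖ ≠ 0 := norm_ne_zero_iff.2 he
      simp [hw, norm_smul, this]
    · rintro ⟨e, he⟩ ⟨e', he'⟩ hne
      have : e ≠ e' := fun h => hne (by simp [h])
      simp [hw, inner_smul_left, inner_smul_right, hW e e' this]
  -- The normalised nonzero vectors are completed to a Hilbert basis. The added basis vectors are
  -- orthogonal to every $W_e$, so $B$ kills them, and zero eigenvalues add no entropy.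
  obtain ⟨v, b, hsv, hb⟩ := hworth.toSubtypeRange.exists_hilbertBasis_extension
  set g : S → v := fun e => ⟨w e, hsv ⟨e, rfl⟩⟩ with hg
  have hginj : Function.Injective g := fun a a' h => hworth.linearIndependent.injective
    (congrArg Subtype.val h)
  set p : v → ℝ := fun u => RCLike.re (inner ℂ (u : ℓ²(ι, ℂ)) (B u)) with hp
  have hBw : ∀ e : S, B (w e) = ((‖W e‖ ^ 2 : ℝ) : ℂ) • w e := by
    intro e
    simp only [hw, map_smul, hBW]
    rw [smul_comm]
  have hpg : ∀ e : S, p (g e) = ‖W e‖ ^ 2 := by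
    intro e
    simp only [hp, hg]
    rw [hBw, inner_smul_right, inner_self_eq_norm_sq_to_K, hworth.1 e]
    simp only [RCLike.ofReal_one, one_pow, mul_one]
    exact Complex.ofReal_re _
  have hout : ∀ u : v, u ∉ Set.range g → B u = 0 := by
    intro u hu
    refine (happ u).unique ?_
    convert! (hasSum_zero : HasSum (fun _ : ε => (0 : ℓ²(ι, ℂ))) 0) using 1
    ext1 e
    by_cases he : W e = 0
    · simp [he]
    · have hne : g ⟨e, he⟩ ≠ u := fun h => hu ⟨_, h⟩
      have h2 := b.orthonormal.2 hne
      rw [hb] at h2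
      simp only [hg, hw, inner_smul_left, mul_eq_zero] at h2
      rcases h2 with h2 | h2
      · simp [he] at h2
      · rw [h2, zero_smul]
  have hpout : ∀ u : v, u ∉ Set.range g → p u = 0 := by
    intro u hu
    simp [hp, hout u hu]
  rw [vonNeumannEntropy_eq_of_hilbertBasis hsa b (p := p) ?_ ?_ ?_]
  · rw [← shannonEntropy_comp_injective hginj p hpout, ← shannonEntropy_comp_injective
      (g := ((↑) : S → ε)) Subtype.val_injective (fun e => ‖W e‖ ^ 2)]
    · simp only [hpg]
    · intro e he
      simp only [Subtype.range_coe_subtype, Set.mem_ofPred_eq, hS, not_not] at he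
      simp [he]
  · intro u
    rw [hb]
    by_cases hu : u ∈ Set.range g
    · obtain ⟨e, rfl⟩ := hu
      rw [hpg]
      exact hBw e
    · rw [hout u hu, hpout u hu]; simp
  · intro u
    by_cases hu : u ∈ Set.range g
    · obtain ⟨e, rfl⟩ := hu
      rw [hpg]; positivity
    · rw [hpout u hu]
  · intro u
    by_cases hu : u ∈ Set.range g
    · obtain ⟨e, rfl⟩ := hu
      rw [hpg]; exact h1 _
    · rw [hpout u hu]; exact zero_le_one

/-! ### Kraus decomposition of the attenuator with Fock state environment -/

theorem sliceR_apply {ι κ : Type*} (k : κ) (x : ℓ²(ι × κ, ℂ)) (i : ι) : sliceR k x i = x (i, k) :=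
  rfl

theorem hasSum_norm_sliceR {ι κ : Type*} (x : ℓ²(ι × κ, ℂ)) :
    HasSum (fun k => ‖sliceR k x‖ ^ 2) (‖x‖ ^ 2) := by
  have h1 : HasSum (fun p : κ × ι => ‖x (p.2, p.1)‖ ^ 2) (‖x‖ ^ 2) :=
    ((Equiv.prodComm κ ι).hasSum_iff (f := fun i => ‖x i‖ ^ 2)).2 (hasSum_sq x)
  exact h1.prod_fiberwise fun k => hasSum_sq (sliceR k x)

theorem adjoint_sliceR_apply {ι κ : Type*} [DecidableEq κ] (k : κ) (a : ℓ²(ι, ℂ)) (p : ι × κ) :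
    ContinuousLinearMap.adjoint (sliceR k) a p = if p.2 = k then a p.1 else 0 := by
  classical
  rw [← inner_ket, ContinuousLinearMap.adjoint_inner_right]
  split_ifs with h
  · have : sliceR k (ket p) = ket p.1 := by
      ext i
      rw [sliceR_apply, ket_apply, ket_apply]
      simp [Prod.ext_iff, h]
    rw [this, inner_ket]
  · have : sliceR k (ket p) = (0 : ℓ²(ι, ℂ)) := by
      ext i
      rw [sliceR_apply, ket_apply]
      simp [Prod.ext_iff, Ne.symm h]
    rw [this, inner_zero_left]

theorem adjoint_sliceR_ket {ι κ : Type*} (i : ι) (k : κ) :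
    ContinuousLinearMap.adjoint (sliceR k) (ket i) = ket (i, k) := by
  classical
  ext p
  rw [adjoint_sliceR_apply, ket_apply, ket_apply]
  by_cases h : p.2 = k <;> simp [Prod.ext_iff, h]

theorem norm_adjoint_sliceR_le {ι κ : Type*} (k : κ) (a : ℓ²(ι, ℂ)) :
    ‖ContinuousLinearMap.adjoint (sliceR k) a‖ ≤ ‖a‖ := by
  refine (ContinuousLinearMap.le_opNorm _ _).trans ?_
  rw [LinearIsometryEquiv.norm_map]
  exact mul_le_of_le_one_left (norm_nonneg _) (norm_mkOp_le _ _ _ _)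

theorem tensorOp_fockState (A : Op ℕ) (n : ℕ) :
    tensorOp A (fockState n) = ContinuousLinearMap.adjoint (sliceR n) ∘L A ∘L sliceR n := by
  ext1 x
  ext ⟨i, k⟩
  have h : sliceR k (oneTensor ℕ (fockState n) x) = if k = n then sliceR n x else 0 := by
    ext j
    have : sliceR k (oneTensor ℕ (fockState n) x) j = proj (ket n) (sliceL j x) k := rfl
    rw [this, proj_apply, inner_ket]
    have h' : (sliceL j x) n = x (j, n) := rfl
    rw [h', lp.coeFn_smul, Pi.smul_apply, ket_apply]
    split_ifs <;> simp [sliceR_apply]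
  rw [ContinuousLinearMap.comp_apply, ContinuousLinearMap.comp_apply, adjoint_sliceR_apply]
  have h2 : tensorOp A (fockState n) x (i, k) = A (sliceR k (oneTensor ℕ (fockState n) x)) i := rfl
  rw [h2, h]
  split_ifs <;> simp

/-- The Kraus operators `(1 ⊗ ⟨e|) U (1 ⊗ |n⟩)`. -/
def krausOp (θ : ℝ) (n e : ℕ) : Op ℕ :=
  sliceR e ∘L beamSplitterRotation θ ∘L ContinuousLinearMap.adjoint (sliceR n)

/-- A pure environment gives the Kraus form: $A\otimes|n\rangle\langle
n|=(1\otimes|n\rangle)A(1\otimes\langle n|)$, and the partial trace runs over the environment output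
$e$. -/
theorem attenuator_eq_tsum (l : ℝ) (n : ℕ) (A : Op ℕ) :
    attenuator l (fockState n) A = ∑' e, krausOp (Real.arccos √l) n e ∘L A ∘L
      ContinuousLinearMap.adjoint (krausOp (Real.arccos √l) n e) := by
  rw [attenuator, partialTrace, tensorOp_fockState]
  refine tsum_congr fun e => ?_
  rw [krausOp, ContinuousLinearMap.adjoint_comp, ContinuousLinearMap.adjoint_comp,
    ContinuousLinearMap.adjoint_adjoint]
  rfl

theorem sum_norm_krausOp_sq_le (θ : ℝ) (n : ℕ) (a : ℓ²(ℕ, ℂ)) (s : Finset ℕ) :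
    ∑ e ∈ s, ‖krausOp θ n e a‖ ^ 2 ≤ ‖a‖ ^ 2 := by
  refine (sum_le_hasSum s (fun _ _ => by positivity) (hasSum_norm_sliceR (beamSplitterRotation θ
    (ContinuousLinearMap.adjoint (sliceR n) a)))).trans ?_
  gcongr
  exact (norm_beamSplitterRotation_le _ _).trans (norm_adjoint_sliceR_le _ _)

theorem krausOp_ket (θ : ℝ) (n e m i : ℕ) : krausOp θ n e (ket m) i = amplitude θ m n (i, e) := by
  rw [krausOp, ContinuousLinearMap.comp_apply, ContinuousLinearMap.comp_apply, adjoint_sliceR_ket,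
    sliceR_apply, beamSplitterRotation_ket]

/-- Photon conservation leaves the single input number $m=i+e-n$: each Kraus operator is a weighted
shift of the Fock basis. -/
theorem krausOp_apply (θ : ℝ) (n e : ℕ) (a : ℓ²(ℕ, ℂ)) (i : ℕ) : krausOp θ n e a i
    = if n ≤ i + e then a (i + e - n) * amplitude θ (i + e - n) n (i, e) else 0 := by
  have h : HasSum (fun m => a m * amplitude θ m n (i, e)) (krausOp θ n e a i) := by
    have := (hasSum_ket a).mapL (krausOp θ n e)
    have := this.mapL (innerSL ℂ (ket i))
    simp only [map_smul, innerSL_apply_apply, inner_ket, krausOp_ket, smul_eq_mul] at this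
    exact this
  refine h.unique ?_
  split_ifs with hn
  · refine hasSum_single _ fun m hm => ?_
    rw [amplitude_eq_zero (by simp only; omega), mul_zero]
  · convert! hasSum_zero using 1
    ext m
    rw [amplitude_eq_zero (by simp only; omega), mul_zero]

/-- The map `A ↦ V A W†`. -/
def sandwich {ι κ : Type*} (V W : ℓ²(ι, ℂ) →L[ℂ] ℓ²(κ, ℂ)) : Op ι →L[ℂ] Op κ :=
  (ContinuousLinearMap.compL ℂ _ _ _ V) ∘L
    ((ContinuousLinearMap.compL ℂ _ _ _).flip (ContinuousLinearMap.adjoint W))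

theorem sandwich_apply {ι κ : Type*} (V W : ℓ²(ι, ℂ) →L[ℂ] ℓ²(κ, ℂ)) (A : Op ι) :
    sandwich V W A = V ∘L A ∘L ContinuousLinearMap.adjoint W := rfl

theorem sandwich_rankOne {ι κ : Type*} (V W : ℓ²(ι, ℂ) →L[ℂ] ℓ²(κ, ℂ)) (x y : ℓ²(ι, ℂ)) :
    sandwich V W (InnerProductSpace.rankOne ℂ x y) = InnerProductSpace.rankOne ℂ (V x) (W y) := by
  ext1 z
  simp [sandwich_apply, ContinuousLinearMap.adjoint_inner_right]

theorem hasSum_thermalState {N : ℝ} (hN : 0 < N) :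
    HasSum (fun m => (thermalWeight N m : ℂ) • proj (ket m)) (thermalState N) := by
  have hs : Summable fun m : ℕ => (N / (N + 1)) ^ m • fockState m := by
    refine Summable.of_norm ?_
    have := summable_geometric_of_lt_one (by positivity) (ratio_lt_one hN)
    refine this.congr fun m => ?_
    rw [norm_smul, fockState, norm_proj, norm_ket, Real.norm_eq_abs, abs_of_nonneg (by positivity)]
    simp
  have h := hs.hasSum.const_smul (1 / (N + 1))
  convert! h using 1
  ext1 m
  rw [smul_smul, thermalWeight, fockState]
  ext x i
  simp

/-- The output of the attenuator on a thermal state. -/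
theorem hasSum_attenuator_thermalState {N : ℝ} (hN : 0 < N) (l : ℝ) (n : ℕ) :
    HasSum (fun p : ℕ × ℕ => (thermalWeight N p.1 : ℂ)
        • proj (krausOp (Real.arccos √l) n p.2 (ket p.1)))
      (attenuator l (fockState n) (thermalState N)) := by
  set V := krausOp (Real.arccos √l) n
  have hb : ∀ m, ∀ s : Finset ℕ, ∑ e ∈ s, thermalWeight N m * ‖V e (ket m)‖ ^ 2 ≤ thermalWeight N m := by
    intro m s
    rw [← Finset.mul_sum]
    refine mul_le_of_le_one_right (thermalWeight_nonneg hN m) ?_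
    simpa [norm_ket] using sum_norm_krausOp_sq_le (Real.arccos √l) n (ket m) s
  have hnn : ∀ p : ℕ × ℕ, 0 ≤ thermalWeight N p.1 * ‖V p.2 (ket p.1)‖ ^ 2 := fun p =>
    mul_nonneg (thermalWeight_nonneg hN _) (by positivity)
  have hsum : Summable fun p : ℕ × ℕ => (thermalWeight N p.1 : ℂ) • proj (V p.2 (ket p.1)) := by
    refine Summable.of_norm ?_
    have : Summable fun p : ℕ × ℕ => thermalWeight N p.1 * ‖V p.2 (ket p.1)‖ ^ 2 := by
      rw [summable_prod_of_nonneg hnn]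
      have hs : ∀ m, Summable fun e => thermalWeight N m * ‖V e (ket m)‖ ^ 2 := fun m =>
        summable_of_sum_le (fun e => hnn (m, e)) (hb m)
      exact ⟨hs, (hasSum_thermalWeight hN).summable.of_nonneg_of_le
        (fun m => tsum_nonneg fun e => hnn (m, e)) fun m => (hs m).tsum_le_of_sum_le (hb m)⟩
    refine this.congr fun p => ?_
    rw [norm_smul, norm_proj, Complex.norm_real, Real.norm_eq_abs,
      abs_of_nonneg (thermalWeight_nonneg hN _)]
  have h1 : HasSum (fun e => V e ∘L thermalState N ∘L ContinuousLinearMap.adjoint (V e))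
      (∑' p : ℕ × ℕ, (thermalWeight N p.1 : ℂ) • proj (V p.2 (ket p.1))) := by
    refine ((Equiv.prodComm ℕ ℕ).hasSum_iff.2 hsum.hasSum).prod_fiberwise fun e => ?_
    have := (hasSum_thermalState hN).mapL (sandwich (V e) (V e))
    simp only [map_smul, proj, sandwich_rankOne] at this
    exact this
  rw [attenuator_eq_tsum, h1.tsum_eq]
  exact hsum.hasSum

/-- The Kraus operator for $e$ maps $|m\rangle$ to a multiple of $|m+n-e\rangle$, so the output is
diagonal in the Fock basis and its eigenvalues are the output photon probabilities. -/
theorem vonNeumannEntropy_attenuator {N : ℝ} (hN : 0 < N) (l : ℝ) (n : ℕ) :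
    vonNeumannEntropy (attenuator l (fockState n) (thermalState N))
      = shannonEntropy (outDist N (Real.arccos √l) n) := by
  set θ := Real.arccos √l
  have hsum := hasSum_attenuator_thermalState hN l n
  have hsa : IsSelfAdjoint (attenuator l (fockState n) (thermalState N)) := by
    have h := hsum.star
    simp only [star_smul, (isSelfAdjoint_proj _).star_eq, Complex.star_def, Complex.conj_ofReal] at h
    exact h.unique hsum
  have happ : ∀ i j : ℕ, HasSum (fun p : ℕ × ℕ => (thermalWeight N p.1 : ℂ)
      * (star (amplitude θ p.1 n (i, p.2)) * amplitude θ p.1 n (j, p.2)))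
      (attenuator l (fockState n) (thermalState N) (ket i) j) := by
    intro i j
    have h := (hsum.mapL (ContinuousLinearMap.apply ℂ _ (ket i))).mapL (innerSL ℂ (ket j))
    simp only [innerSL_apply_apply, inner_ket, ContinuousLinearMap.apply_apply] at h
    convert! h using 1
    ext1 p
    rw [smul_apply, proj_apply, ← inner_conj_symm, inner_ket, krausOp_ket, lp.coeFn_smul,
      Pi.smul_apply, lp.coeFn_smul, Pi.smul_apply, krausOp_ket]
    rfl
  have hle : ∀ i m : ℕ, (if i ≤ m + n then thermalWeight N m * transProb θ n m (m + n - i) else 0)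
      ≤ thermalWeight N m := by
    intro i m
    split_ifs
    · exact mul_le_of_le_one_right (thermalWeight_nonneg hN m) (transProb_le_one _ _ _ _)
    · exact thermalWeight_nonneg hN m
  have hnn : ∀ i m : ℕ, 0 ≤ if i ≤ m + n then thermalWeight N m * transProb θ n m (m + n - i) else 0 := by
    intro i m
    split_ifs
    · exact mul_nonneg (thermalWeight_nonneg hN m) (transProb_nonneg _ _ _ _)
    · exact le_rfl
  have hs : ∀ i, Summable fun m => if i ≤ m + n then thermalWeight N m
      * transProb θ n m (m + n - i) else 0 := fun i =>
    (hasSum_thermalWeight hN).summable.of_nonneg_of_le (hnn i) (hle i)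
  refine vonNeumannEntropy_eq_of_ket hsa (fun i => ?_) (fun i => tsum_nonneg (hnn i)) fun i => ?_
  · ext j
    rw [lp.coeFn_smul, Pi.smul_apply, ket_apply]
    refine (happ i j).unique ?_
    split_ifs with hij
    · subst hij
      have hf : ∀ m : ℕ, HasSum (fun e : ℕ => (thermalWeight N m : ℂ)
          * (star (amplitude θ m n (j, e)) * amplitude θ m n (j, e)))
          ((if j ≤ m + n then thermalWeight N m * transProb θ n m (m + n - j) else 0 : ℝ) : ℂ) := by
        intro m
        split_ifs with h
        · have hv : ((thermalWeight N m * transProb θ n m (m + n - j) : ℝ) : ℂ)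
              = (thermalWeight N m : ℂ) * (star (amplitude θ m n (j, m + n - j))
                * amplitude θ m n (j, m + n - j)) := by
            rw [transProb, if_pos (by omega), show m + n - (m + n - j) = j by omega,
              Complex.star_def, Complex.conj_mul']
            push_cast; rfl
          rw [hv]
          refine hasSum_single _ fun e he => ?_
          rw [amplitude_eq_zero (by simp only; omega)]; simp
        · rw [Complex.ofReal_zero]
          convert! hasSum_zero using 1
          ext e
          rw [amplitude_eq_zero (by simp only; omega)]; simp
      have h1 := (happ j j).summable.hasSum.prod_fiberwise hf
      have h2 := Complex.hasSum_ofReal.2 (hs j).hasSum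
      rw [smul_eq_mul, mul_one, outDist, ← h1.unique h2]
      exact (happ j j).summable.hasSum
    · rw [smul_zero]
      convert! hasSum_zero using 1
      ext p
      by_cases h : i + p.2 = p.1 + n
      · rw [amplitude_eq_zero (p := (j, p.2)) (by simp only; omega)]; simp
      · rw [amplitude_eq_zero (p := (i, p.2)) (by simpa using h)]; simp
  · rw [← (hasSum_thermalWeight hN).tsum_eq]
    exact (hs i).tsum_le_tsum (hle i) (hasSum_thermalWeight hN).summable

/-! ### The complementary output -/

theorem sliceR_tensorOne {ι κ : Type*} (A : Op ι) (x : ℓ²(ι × κ, ℂ)) (k : κ) :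
    sliceR k (tensorOne κ A x) = A (sliceR k x) := rfl

theorem isTensorIdImage_unique {ι κ : Type*} {Φ : Op ι → Op ι} {A B B' : Op (ι × κ)}
    (h : IsTensorIdImage Φ A B) (h' : IsTensorIdImage Φ A B') : B = B' := by
  refine op_ext fun ⟨j, l⟩ => ?_
  ext ⟨i, k⟩
  have := congrArg (fun T : Op ι => T (ket j) i) ((h k l).trans (h' k l).symm)
  simpa only [ContinuousLinearMap.comp_apply, adjoint_sliceR_ket, sliceR_apply] using this

theorem tensorId_eq {ι κ : Type*} {Φ : Op ι → Op ι} {A B : Op (ι × κ)}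
    (h : IsTensorIdImage Φ A B) : tensorId Φ A = B := by
  have hex : ∃ B, IsTensorIdImage Φ A B := ⟨B, h⟩
  rw [tensorId, dif_pos hex]
  exact isTensorIdImage_unique hex.choose_spec h

theorem summable_norm_krausOp {κ : Type*} (θ : ℝ) (n : ℕ) (ψ : ℓ²(ℕ × κ, ℂ)) :
    Summable fun e => ‖tensorOne κ (krausOp θ n e) ψ‖ ^ 2 := by
  refine summable_of_sum_le (c := ‖ψ‖ ^ 2) (fun e => by positivity) fun s => ?_
  refine hasSum_le (fun k => ?_) (hasSum_sum fun e _ => hasSum_norm_sliceR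
    (tensorOne κ (krausOp θ n e) ψ)) (hasSum_norm_sliceR ψ)
  exact sum_norm_krausOp_sq_le θ n (sliceR k ψ) s

/-- The sum of projections has the prescribed blocks, by the Kraus form applied to
$|\psi_k\rangle\langle\psi_l|$, and blocks determine an operator. -/
theorem hasSum_tensorId_attenuator {κ : Type*} (l : ℝ) (n : ℕ) (ψ : ℓ²(ℕ × κ, ℂ)) :
    HasSum (fun e => proj (tensorOne κ (krausOp (Real.arccos √l) n e) ψ))
      (tensorId (attenuator l (fockState n)) (proj ψ)) := by
  have hs : Summable fun e => proj (tensorOne κ (krausOp (Real.arccos √l) n e) ψ) := by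
    refine Summable.of_norm ?_
    simpa only [norm_proj] using summable_norm_krausOp (Real.arccos √l) n ψ
  rw [tensorId_eq (B := ∑' e, proj (tensorOne κ (krausOp (Real.arccos √l) n e) ψ))]
  · exact hs.hasSum
  · intro k l'
    rw [← sandwich_apply, ← sandwich_apply, (sandwich (sliceR k) (sliceR l')).map_tsum hs,
      attenuator_eq_tsum]
    refine tsum_congr fun e => ?_
    rw [proj, proj, sandwich_rankOne, sandwich_rankOne, ← sandwich_apply, sandwich_rankOne,
      sliceR_tensorOne, sliceR_tensorOne]

/-- Comparing matrix elements of the reduced state: the vectors $\psi(m,\cdot)$ are orthogonal with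
squared norms the thermal weights. Nothing else about the purification is used later. -/
theorem hasSum_purification {N : ℝ} (hN : 0 < N) {κ : Type*} {ψ : ℓ²(ℕ × κ, ℂ)}
    (hψ : IsPurification (thermalState N) ψ) (m m' : ℕ) :
    HasSum (fun k => star (ψ (m, k)) * ψ (m', k)) (if m = m' then (thermalWeight N m : ℂ) else 0) := by
  have hs : Summable fun k : κ => proj (sliceR k ψ) := by
    refine Summable.of_norm ?_
    simpa only [norm_proj] using (hasSum_norm_sliceR ψ).summable
  have h1 : HasSum (fun k : κ => proj (sliceR k ψ)) (thermalState N) := by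
    rw [← hψ, partialTrace]
    have : ∀ k : κ, sliceR k ∘L proj ψ ∘L ContinuousLinearMap.adjoint (sliceR k)
        = proj (sliceR k ψ) := fun k => sandwich_rankOne (sliceR k) (sliceR k) ψ ψ
    simp only [this]
    exact hs.hasSum
  have h2 := (h1.mapL (ContinuousLinearMap.apply ℂ _ (ket m))).mapL (innerSL ℂ (ket m'))
  have h3 := ((hasSum_thermalState hN).mapL (ContinuousLinearMap.apply ℂ _ (ket m))).mapL
    (innerSL ℂ (ket m'))
  simp only [innerSL_apply_apply, inner_ket, ContinuousLinearMap.apply_apply] at h2 h3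
  have h4 : (thermalState N (ket m)) m' = if m = m' then (thermalWeight N m : ℂ) else 0 := by
    refine h3.unique ?_
    convert! hasSum_ite_eq m (if m = m' then (thermalWeight N m : ℂ) else 0) using 1
    ext1 j
    rw [smul_apply, proj_apply, inner_ket, lp.coeFn_smul, Pi.smul_apply, lp.coeFn_smul,
      Pi.smul_apply, ket_apply, ket_apply]
    by_cases h : j = m
    · subst h; simp [eq_comm]
    · simp [h]
  rw [← h4]
  convert! h2 using 1
  ext1 k
  rw [proj_apply, ← inner_conj_symm, inner_ket, lp.coeFn_smul, Pi.smul_apply, sliceR_apply, sliceR_apply]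
  rfl

/-- At a fixed signal output $i$, the outcomes $e$ and $e'$ come from inputs $i+e-n$ and $i+e'-n$.
For $e\ne e'$ these differ, so the corresponding purification slices are orthogonal. -/
theorem hasSum_inner_krausOp {N : ℝ} (hN : 0 < N) {κ : Type*} {ψ : ℓ²(ℕ × κ, ℂ)}
    (hψ : IsPurification (thermalState N) ψ) (θ : ℝ) (n e e' : ℕ) :
    HasSum (fun i : ℕ => if n ≤ i + e ∧ n ≤ i + e' ∧ e = e' then
        star (amplitude θ (i + e - n) n (i, e)) * amplitude θ (i + e - n) n (i, e)
          * (thermalWeight N (i + e - n) : ℂ) else 0)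
      (inner ℂ (tensorOne κ (krausOp θ n e) ψ) (tensorOne κ (krausOp θ n e') ψ)) := by
  refine (lp.hasSum_inner (tensorOne κ (krausOp θ n e) ψ)
    (tensorOne κ (krausOp θ n e') ψ)).prod_fiberwise fun i => ?_
  have hap : ∀ (e : ℕ) (k : κ), tensorOne κ (krausOp θ n e) ψ (i, k) = if n ≤ i + e then
      ψ (i + e - n, k) * amplitude θ (i + e - n) n (i, e) else 0 := fun e k =>
    krausOp_apply θ n e (sliceR k ψ) i
  simp only [hap]
  by_cases h1 : n ≤ i + e
  · by_cases h2 : n ≤ i + e'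
    · simp only [h1, h2, if_true, true_and]
      have h := (hasSum_purification hN hψ (i + e - n) (i + e' - n)).mul_left
        (star (amplitude θ (i + e - n) n (i, e)) * amplitude θ (i + e' - n) n (i, e'))
      convert! h using 1
      · ext1 k
        simp only [RCLike.inner_apply, map_mul, Complex.star_def]
        ring
      · by_cases he : e = e'
        · subst he; simp
        · rw [if_neg he, if_neg (by omega), mul_zero]
    · simp [h2]
  · simp [h1]

theorem inner_krausOp_eq_zero {N : ℝ} (hN : 0 < N) {κ : Type*} {ψ : ℓ²(ℕ × κ, ℂ)}
    (hψ : IsPurification (thermalState N) ψ) (θ : ℝ) (n : ℕ) {e e' : ℕ} (he : e ≠ e') :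
    inner ℂ (tensorOne κ (krausOp θ n e) ψ) (tensorOne κ (krausOp θ n e') ψ) = 0 := by
  have h := hasSum_inner_krausOp hN hψ θ n e e'
  simp only [he, and_false, if_false] at h
  exact h.unique hasSum_zero

theorem norm_krausOp_sq {N : ℝ} (hN : 0 < N) {κ : Type*} {ψ : ℓ²(ℕ × κ, ℂ)}
    (hψ : IsPurification (thermalState N) ψ) (θ : ℝ) (n e : ℕ) :
    ‖tensorOne κ (krausOp θ n e) ψ‖ ^ 2 = envDist N θ n e := by
  have h := hasSum_inner_krausOp hN hψ θ n e e
  rw [inner_self_eq_norm_sq_to_K] at h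
  have h' : HasSum (fun i : ℕ => if n ≤ i + e then
      ‖amplitude θ (i + e - n) n (i, e)‖ ^ 2 * thermalWeight N (i + e - n) else 0)
      (‖tensorOne κ (krausOp θ n e) ψ‖ ^ 2) := by
    rw [← Complex.hasSum_ofReal]
    convert! h using 1
    · ext1 i
      by_cases hi : n ≤ i + e
      · simp [hi, Complex.conj_mul']
      · simp [hi]
    · simp
  -- The relation $i+e=m+n$ is parametrised by $i=d+(n-e)$, $m=d+(e-n)$; with truncated subtraction
  -- this covers both $e\le n$ and $e\ge n$.
  rw [← h'.tsum_eq, envDist, ← (add_left_injective (n - e)).tsum_eq, ← (add_left_injective (e - n)).tsum_eq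
    (f := fun m => thermalWeight N m * transProb θ n m e)]
  · refine tsum_congr fun d => ?_
    have e1 : d + (n - e) + e - n = d + (e - n) := by omega
    have e2 : d + (e - n) + n - e = d + (n - e) := by omega
    rw [if_pos (by omega), e1, transProb, if_pos (by omega), e2, mul_comm]
  · intro m hm
    rw [Function.mem_support, transProb] at hm
    by_cases h : e ≤ m + n
    · exact ⟨m - (e - n), Nat.sub_add_cancel (by omega)⟩
    · simp [h] at hm
  · intro i hi
    rw [Function.mem_support] at hi
    by_cases h : n ≤ i + e
    · exact ⟨i - (n - e), Nat.sub_add_cancel (by omega)⟩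
    · simp [h] at hi

theorem vonNeumannEntropy_tensorId {N : ℝ} (hN : 0 < N) {κ : Type*} {ψ : ℓ²(ℕ × κ, ℂ)}
    (hψ : IsPurification (thermalState N) ψ) (l : ℝ) (n : ℕ) :
    vonNeumannEntropy (tensorId (attenuator l (fockState n)) (proj ψ))
      = shannonEntropy (envDist N (Real.arccos √l) n) := by
  rw [vonNeumannEntropy_eq_of_orthogonal (fun e e' he => inner_krausOp_eq_zero hN hψ _ n he)
    (hasSum_tensorId_attenuator l n ψ)]
  · simp only [norm_krausOp_sq hN hψ]
  · intro e
    rw [norm_krausOp_sq hN hψ, ← (hasSum_thermalWeight hN).tsum_eq]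
    exact (summable_envDist hN _ n e).tsum_le_tsum
      (fun m => mul_le_of_le_one_right (thermalWeight_nonneg hN m) (transProb_le_one _ _ _ _))
      (hasSum_thermalWeight hN).summable

end Bosonic

end

theorem mainTheorem3 (N c : ℝ) (hN : 0 < N) (hc : 0 < c) :
    ((∀ k, 0 ≤ Bosonic.qDist N c k) ∧ HasSum (Bosonic.qDist N c) 1) ∧
    ((∀ k, 0 ≤ Bosonic.pDist N c k) ∧ HasSum (Bosonic.pDist N c) 1) ∧
    Bosonic.shannonEntropy (Bosonic.qDist N c) ≠ ⊤ ∧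
    Bosonic.shannonEntropy (Bosonic.pDist N c) ≠ ⊤ ∧
    ∀ {κ : Type*} (ψ : lp (fun _ : ℕ × κ => ℂ) 2),
      Bosonic.IsPurification (Bosonic.thermalState N) ψ →
      Filter.liminf (fun n : ℕ => Bosonic.coherentInformation
          (Bosonic.attenuator (c / n) (Bosonic.fockState n)) (Bosonic.thermalState N) ψ)
        Filter.atTop
      ≥ (Bosonic.shannonEntropy (Bosonic.qDist N c) : EReal)
        - (Bosonic.shannonEntropy (Bosonic.pDist N c) : EReal) := by
  refine ⟨⟨Bosonic.qDist_nonneg N c hN hc, Bosonic.hasSum_qDist N c hN hc⟩,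
    ⟨Bosonic.pDist_nonneg N c hN hc, Bosonic.hasSum_pDist N c hN⟩,
    Bosonic.shannonEntropy_qDist_ne_top hN hc, Bosonic.shannonEntropy_pDist_ne_top hN hc, ?_⟩
  intro κ ψ hψ
  simp only [Bosonic.coherentInformation, Bosonic.vonNeumannEntropy_attenuator hN,
    Bosonic.vonNeumannEntropy_tensorId hN hψ]
  exact Bosonic.liminf_entropy_sub hN hc
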